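/- Let $G:\,]0,\infty[\,\to\mathbb R$ be completely monotonic (smooth, with $(-1)^nG^{(n)}(t)\ge 0$ for all $n\ge 0$, $t>0$) and locally integrable on $[0,\infty[$, let $\rho>0$, and suppose that $G_\infty:=\lim_{t\to\infty}G(t)>0$. For $\operatorname{Re}p>0$ put $$Q(p)=p\int_0^\infty G(t)\,e^{-pt}\,dt,\qquad \kappa(p)=\rho^{1/2}\,p\,/\,Q(p)^{1/2}$$ (principal square root). Then there are a number $B\ge 0$ and a positive Radon measure $\nu$ on $]0,\infty[$ with $\int_{]0,\infty[}\frac{\nu(dr)}{1+r}<\infty$ such that $$\kappa(p)=B\,p+\beta(p),\qquad \beta(p):=p\int_{]0,\infty[}\frac{\nu(dr)}{p+r},\qquad \operatorname{Re}p>0;$$ the right-hand side continues $\kappa$ analytically to the plane cut along the negative real axis. For every such pair $(B,\nu)$ put $c_\infty:=1/B\in\,]0,\infty]$ (with $1/c_\infty=0$ if $c_\infty=\infty$) and, for real $\omega\ne0$, $$\mathcal A(\omega):=\operatorname{Re}\beta(-i\omega),\qquad \mathcal D(\omega):=-\operatorname{Im}\beta(-i\omega),\qquad c(\omega):=-\omega/\operatorname{Im}\kappa(-i\omega).$$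 Let $c_0:=(G_\infty/\rho)^{1/2}$. Then: 1. $\kappa(p)/p\to 1/c_0$ as $p\to0$, $\operatorname{Re}p\ge0$, $p\neq 0$; 2. $\mathcal A(\omega)/\omega\to0$ as $\omega\to0$; 3. the limit $D:=\lim_{\omega\to0}\mathcal D(\omega)/\omega$ exists and is finite, and $D\ge 0$; 4. $1/c_0=\lim_{\omega\to0}[1/c(\omega)]=1/c_\infty+D$; 5. $D=\int_{[0,\infty[}\frac{\nu(dr)}{r}<\infty$. -/

import Mathlib

open Set Filter Topology MeasureTheory
open scoped ENNReal

/-- Complete monotonicity on the open half-line `x > 0`: the function is smooth there and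
`(-1)^n f^(n)(x) ≥ 0` for all `n ≥ 0`, `x > 0`. -/
def IsCompletelyMonotone (f : ℝ → ℝ) : Prop :=
  ContDiffOn ℝ (⊤ : ℕ∞) f (Ioi 0) ∧
    ∀ (n : ℕ) (x : ℝ), 0 < x → 0 ≤ (-1 : ℝ) ^ n * iteratedDerivWithin n f (Ioi 0) x

/-- Locally integrable (on `[0,∞[`) completely monotonic functions. -/
def IsLICM (f : ℝ → ℝ) : Prop :=
  IsCompletelyMonotone f ∧ LocallyIntegrableOn f (Ici 0) volume

/-- The class of positive Radon measures `ν` on `[0,∞[` with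
`∫_{]0,∞[} ν(dr) / (1 + r) < ∞`. A measure on `[0,∞[` is a measure on `ℝ` that does not charge
the negative half-line. -/
structure IsSpectralMeasure (ν : Measure ℝ) : Prop where
  locallyFinite : IsLocallyFiniteMeasure ν
  measure_neg : ν (Iio 0) = 0
  lintegral_lt_top : ∫⁻ r in Ioi (0 : ℝ), (ENNReal.ofReal (1 + r))⁻¹ ∂ν < ∞

/-- `Q(p) = p * ∫_0^∞ G(t) exp(-p t) dt` in the right half-plane. -/
noncomputable def modulusQ (G : ℝ → ℝ) (p : ℂ) : ℂ :=
  p * ∫ t in Ioi (0 : ℝ), (G t : ℂ) * Complex.exp (-p * t)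

/-- The complex wave number function `κ(p) = ρ^{1/2} p / Q(p)^{1/2}` in the right half-plane,
with the principal square root. -/
noncomputable def waveNumber (G : ℝ → ℝ) (ρ : ℝ) (p : ℂ) : ℂ :=
  (Real.sqrt ρ : ℂ) * p / (modulusQ G p) ^ (1 / 2 : ℂ)

/-- The dispersion-attenuation function `β(p) = p ∫_{]0,∞[} ν(dr) / (p + r)` on the complex plane
cut along the negative real axis. -/
noncomputable def dispAtten (ν : Measure ℝ) (p : ℂ) : ℂ :=
  p * ∫ r in Ioi (0 : ℝ), (p + (r : ℂ))⁻¹ ∂ν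

/-- `B p + β(p)`: the analytic continuation of `κ` from the right half-plane to the cut plane. -/
noncomputable def waveNumberExt (B : ℝ) (ν : Measure ℝ) (p : ℂ) : ℂ :=
  (B : ℂ) * p + dispAtten ν p

/-- `B ≥ 0` and the measure `ν` on `]0,∞[` are the data of the integral representation
`κ(p) = B p + p ∫_{]0,∞[} ν(dr) / (p + r)` of the wave number function of the medium `(G, ρ)`,
i.e. `ν` is its dispersion-attenuation spectral measure. -/
structure IsWaveNumberRep (G : ℝ → ℝ) (ρ B : ℝ) (ν : Measure ℝ) : Prop where
  nonneg : 0 ≤ B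
  spectral : IsSpectralMeasure ν
  measure_zero : ν {0} = 0
  rep : ∀ p : ℂ, 0 < p.re → waveNumber G ρ p = waveNumberExt B ν p

/-- The attenuation function `A(ω) = Re β(-iω)`. -/
noncomputable def attenuation (ν : Measure ℝ) (ω : ℝ) : ℝ :=
  (dispAtten ν (-(Complex.I * (ω : ℂ)))).re

/-- The dispersion function `D(ω) = -Im β(-iω)`. -/
noncomputable def dispersion (ν : Measure ℝ) (ω : ℝ) : ℝ :=
  -(dispAtten ν (-(Complex.I * (ω : ℂ)))).im

/-- The phase speed `c(ω) = -ω / Im κ(-iω)`. -/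
noncomputable def phaseSpeed (B : ℝ) (ν : Measure ℝ) (ω : ℝ) : ℝ :=
  -ω / (waveNumberExt B ν (-(Complex.I * (ω : ℂ)))).im

/-- The wavefront speed `c_∞ = 1 / B ∈ ]0,∞]`, equal to `∞` if `B = 0`. -/
noncomputable def wavefrontSpeed (B : ℝ) : ℝ≥0∞ := (ENNReal.ofReal B)⁻¹

/-- The low-frequency speed `c_0 = (G_∞ / ρ)^{1/2}`. -/
noncomputable def lowFreqSpeed (Ginf ρ : ℝ) : ℝ := Real.sqrt (Ginf / ρ)

/-! Existence rests on showing that `Q ^ (-1/2)` is a Stieltjes function, that is, a mixture of the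
functions `1 / (p + r)`. The mixing measures live on the compactified half-line `r ∈ [0, ∞]`, so
weak compactness makes the class closed under pointwise limits (`IsStieltjes.of_tendsto`), and only
explicit approximants have to be treated. The Hausdorff moment construction approximates `G - G_∞`
by sums of decaying exponentials (`IsCompletelyMonotone.exists_expSum_tendsto`), hence `Q` by finite
sums `G_∞ + ∑ a p / (p + r)`. Their reciprocals are Stieltjes by the spectral theorem for a rank-one
perturbation of a diagonal matrix (`finiteBernstein_inv_eq`). In the limit every `1 / (sin² θ + Q
cos² θ)` is Stieltjes. Averages of these over equally spaced angles converge to `Q ^ (-1/2)`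
(`tendsto_sqrtApprox`). Since `Re Q ≥ G_∞ > 0`, the result is bounded on the positive axis, so it
has no mass at `r = 0`; the mass at `r = ∞` is `B` (`IsStieltjes.exists_rep`). For the asymptotics,
write `β(p) = p F(p)` with `F(p) = ∫ ν(dr) / (p + r)`. The Abelian limit `Q(x) → G_∞` gives `F(x) →
D = 1/c₀ - B` as `x ↓ 0`, and monotone convergence identifies `D` with `∫ ν(dr) / r`. Now `1 / r` is
an integrable majorant on the whole closed half-plane, so `F(p) → D` there, the imaginary axis
included. All the limits are real or imaginary parts of this one. -/

/-! ### Stieltjes functions and their closure properties -/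

/-- The kernel `1 / (1 - u + p u)`, `u ∈ [0,1]`. With `u = 1 / (1 + r)` it equals
`(1 + r) / (p + r)`, and `u = 0` stands for `r = ∞`. -/
noncomputable def stieltjesKernel (p : ℂ) (u : unitInterval) : ℂ :=
  (1 - (u : ℂ) + p * (u : ℂ))⁻¹

/-- Stieltjes functions on the right half-plane, as mixtures of the kernels `stieltjesKernel`
over a finite measure on the compactified half-line. -/
def IsStieltjes (f : ℂ → ℂ) : Prop :=
  ∃ σ : FiniteMeasure unitInterval, ∀ p : ℂ, 0 < p.re →
    f p = ∫ u, stieltjesKernel p u ∂(σ : Measure unitInterval)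

theorem re_stieltjesKernel_denom_pos {p : ℂ} (hp : 0 < p.re) (u : unitInterval) :
    0 < (1 - (u : ℂ) + p * (u : ℂ)).re := by
  have h0 := u.2.1
  have h1 := u.2.2
  have : (1 - (u : ℂ) + p * (u : ℂ)).re = 1 - (u : ℝ) + p.re * u := by simp
  rw [this]
  rcases eq_or_lt_of_le h1 with h | h
  · rw [h]; linarith
  · have := mul_nonneg hp.le h0
    linarith

theorem continuous_stieltjesKernel {p : ℂ} (hp : 0 < p.re) :
    Continuous (stieltjesKernel p) := by
  unfold stieltjesKernel
  refine Continuous.inv₀ (by fun_prop) fun u h => ?_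
  have := re_stieltjesKernel_denom_pos hp u
  rw [h] at this
  simp at this

theorem integrable_stieltjesKernel {p : ℂ} (hp : 0 < p.re) (σ : FiniteMeasure unitInterval) :
    Integrable (stieltjesKernel p) (σ : Measure unitInterval) :=
  (BoundedContinuousFunction.mkOfCompact ⟨_, continuous_stieltjesKernel hp⟩).integrable _

theorem IsStieltjes.congr {f g : ℂ → ℂ} (hf : IsStieltjes f)
    (h : ∀ p : ℂ, 0 < p.re → g p = f p) : IsStieltjes g := by
  obtain ⟨σ, hσ⟩ := hf
  exact ⟨σ, fun p hp => (h p hp).trans (hσ p hp)⟩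

theorem IsStieltjes.add {f g : ℂ → ℂ} (hf : IsStieltjes f) (hg : IsStieltjes g) :
    IsStieltjes fun p => f p + g p := by
  obtain ⟨σ, hσ⟩ := hf
  obtain ⟨τ, hτ⟩ := hg
  refine ⟨σ + τ, fun p hp => ?_⟩
  change f p + g p = _
  rw [hσ p hp, hτ p hp, FiniteMeasure.toMeasure_add,
    integral_add_measure (integrable_stieltjesKernel hp σ) (integrable_stieltjesKernel hp τ)]

theorem IsStieltjes.const_mul {f : ℂ → ℂ} (hf : IsStieltjes f) {c : ℝ} (hc : 0 ≤ c) :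
    IsStieltjes fun p => (c : ℂ) * f p := by
  obtain ⟨σ, hσ⟩ := hf
  refine ⟨c.toNNReal • σ, fun p hp => ?_⟩
  change (c : ℂ) * f p = _
  rw [hσ p hp, FiniteMeasure.toMeasure_smul, integral_smul_nnreal_measure, NNReal.smul_def,
    Real.coe_toNNReal c hc, Complex.real_smul]

theorem isStieltjes_kernel (u : unitInterval) : IsStieltjes fun p => stieltjesKernel p u := by
  refine ⟨⟨Measure.dirac u, inferInstance⟩, fun p _ => ?_⟩
  simp

theorem isStieltjes_const {c : ℝ} (hc : 0 ≤ c) : IsStieltjes fun _ => (c : ℂ) :=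
  ((isStieltjes_kernel 0).const_mul hc).congr fun p _ => by simp [stieltjesKernel]

theorem isStieltjes_inv_add {r : ℝ} (hr : 0 ≤ r) : IsStieltjes fun p => (p + (r : ℂ))⁻¹ := by
  have h1 : 0 < 1 + r := by linarith
  have hu : (1 + r)⁻¹ ∈ unitInterval := ⟨by positivity, inv_le_one_of_one_le₀ (by linarith)⟩
  refine ((isStieltjes_kernel ⟨_, hu⟩).const_mul hu.1).congr fun p hp => ?_
  have h2 : (1 + r : ℂ) ≠ 0 := by exact_mod_cast h1.ne'
  simp only [stieltjesKernel, Complex.ofReal_inv, Complex.ofReal_add, Complex.ofReal_one]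
  rw [← mul_inv]
  congr 1
  field_simp
  ring

theorem IsStieltjes.sum {ι : Type*} (s : Finset ι) {f : ι → ℂ → ℂ}
    (hf : ∀ i ∈ s, IsStieltjes (f i)) : IsStieltjes fun p => ∑ i ∈ s, f i p := by
  classical
  induction s using Finset.induction_on with
  | empty => simpa using isStieltjes_const (le_refl 0)
  | insert a s ha ih =>
    refine ((hf a (by simp)).add (ih fun i hi => hf i (by simp [hi]))).congr fun p _ => ?_
    rw [Finset.sum_insert ha]

/-- Stieltjes functions are closed under pointwise limits. -/
theorem IsStieltjes.of_tendsto {f : ℕ → ℂ → ℂ} {g : ℂ → ℂ} (hf : ∀ n, IsStieltjes (f n))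
    (h : ∀ p : ℂ, 0 < p.re → Tendsto (fun n => f n p) atTop (𝓝 (g p))) : IsStieltjes g := by
  choose σ hσ using hf
  -- The kernel is identically `1` at `p = 1`, so convergence at this single point bounds all the
  -- masses.
  have hmass : ∀ n, f n 1 = ((σ n).mass : ℝ) := by
    intro n
    rw [hσ n 1 (by simp)]
    have : stieltjesKernel 1 = fun _ => 1 := by
      ext u
      simp [stieltjesKernel]
    rw [this, integral_const, Complex.real_smul, mul_one]
    rfl
  obtain ⟨C, hC⟩ : ∃ C : NNReal, ∀ n, (σ n).mass ≤ C := by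
    have hb := (h 1 (by simp)).norm.bddAbove_range
    obtain ⟨C, hC⟩ := hb
    refine ⟨C.toNNReal, fun n => ?_⟩
    have := hC ⟨n, rfl⟩
    simp only [hmass, Complex.norm_real, NNReal.norm_eq] at this
    exact NNReal.le_toNNReal_of_coe_le this
  -- Finite measures of bounded mass on a compact space are weakly compact. A limit along an
  -- ultrafilter suffices, and the kernel is an admissible test function because it is continuous up
  -- to `u = 0`.
  obtain ⟨τ, -, hτ⟩ := (isCompact_setOfPred_finiteMeasure_le_of_compactSpace
    (E := unitInterval) C).ultrafilter_le_nhds ((hyperfilter ℕ : Ultrafilter ℕ).map σ)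
    (by simp only [le_principal_iff]; exact Filter.mem_map.2 (Filter.univ_mem' hC))
  refine ⟨τ, fun p hp => ?_⟩
  have hτ' : Tendsto σ (hyperfilter ℕ : Filter ℕ) (𝓝 τ) := hτ
  have h1 := (FiniteMeasure.tendsto_iff_forall_integral_rclike_tendsto ℂ).1 hτ'
    (BoundedContinuousFunction.mkOfCompact ⟨_, continuous_stieltjesKernel hp⟩)
  have h2 : Tendsto (fun n => f n p) (hyperfilter ℕ : Filter ℕ) (𝓝 (g p)) :=
    (h p hp).mono_left Nat.hyperfilter_le_atTop
  refine tendsto_nhds_unique h2 (h1.congr fun n => ?_)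
  rw [hσ n p hp]
  rfl

/-! ### Reciprocals of finite complete Bernstein functions -/

/-- The complete Bernstein function `A₀ + ∑ i, a i * p / (p + r i)` of a finite family. -/
noncomputable def finiteBernstein {n : ℕ} (A₀ : ℝ) (a r : Fin n → ℝ) (p : ℂ) : ℂ :=
  A₀ + ∑ i, (a i : ℂ) * (p / (p + r i))

theorem re_div_add_nonneg {p : ℂ} (hp : 0 < p.re) {r : ℝ} (hr : 0 ≤ r) :
    0 ≤ (p / (p + r)).re := by
  rw [Complex.div_re, ← add_div]
  refine div_nonneg ?_ (Complex.normSq_nonneg _)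
  simp only [Complex.add_re, Complex.ofReal_re, Complex.add_im, Complex.ofReal_im, add_zero]
  have := mul_nonneg hp.le (add_nonneg hp.le hr)
  nlinarith [mul_self_nonneg p.im]

theorem le_re_finiteBernstein {n : ℕ} {A₀ : ℝ} {a r : Fin n → ℝ} (ha : ∀ i, 0 ≤ a i)
    (hr : ∀ i, 0 ≤ r i) {p : ℂ} (hp : 0 < p.re) : A₀ ≤ (finiteBernstein A₀ a r p).re := by
  rw [finiteBernstein, Complex.add_re, Complex.ofReal_re, Complex.re_sum]
  refine le_add_of_nonneg_right (Finset.sum_nonneg fun i _ => ?_)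
  rw [Complex.re_ofReal_mul]
  exact mul_nonneg (ha i) (re_div_add_nonneg hp (hr i))

theorem add_ofReal_ne_zero {p : ℂ} (hp : 0 < p.re) {r : ℝ} (hr : 0 ≤ r) : p + (r : ℂ) ≠ 0 := by
  intro h
  have := congrArg Complex.re h
  simp at this
  linarith

section RankOneUpdate

open scoped Matrix

/-- The symmetric matrix `diag r - w wᵀ / A` that represents the reciprocal of a finite complete
Bernstein function. -/
noncomputable def rankOneUpdate {n : ℕ} (A : ℝ) (w r : Fin n → ℝ) : Matrix (Fin n) (Fin n) ℝ :=
  Matrix.diagonal r - A⁻¹ • Matrix.vecMulVec w w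

theorem rankOneUpdate_mulVec {n : ℕ} (A : ℝ) (w r x : Fin n → ℝ) (i : Fin n) :
    (rankOneUpdate A w r *ᵥ x) i = r i * x i - A⁻¹ * (w i * ∑ j, w j * x j) := by
  simp [rankOneUpdate, Matrix.sub_mulVec, Matrix.smul_mulVec, Matrix.mulVec_diagonal,
    Matrix.vecMulVec_mulVec, dotProduct, mul_comm]

theorem rankOneUpdate_isHermitian {n : ℕ} (A : ℝ) (w r : Fin n → ℝ) :
    (rankOneUpdate A w r).IsHermitian := by
  ext i j
  simp only [rankOneUpdate, Matrix.conjTranspose_apply, Matrix.sub_apply, Matrix.smul_apply,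
    Matrix.vecMulVec_apply, star_trivial, smul_eq_mul, mul_comm (w j)]
  by_cases h : i = j
  · simp [h]
  · simp [h, Ne.symm h]

/-- This is Cauchy–Schwarz for the vectors `√a` and `√r x`, with `∑ a ≤ A` absorbing the factor
`A⁻¹`. -/
theorem rankOneUpdate_posSemidef {n : ℕ} {A : ℝ} (hA : 0 < A) {a r : Fin n → ℝ}
    (ha : ∀ i, 0 ≤ a i) (hr : ∀ i, 0 ≤ r i) (hsum : ∑ i, a i ≤ A) :
    (rankOneUpdate A (fun i => √(a i) * √(r i)) r).PosSemidef := by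
  refine Matrix.PosSemidef.of_dotProduct_mulVec_nonneg (rankOneUpdate_isHermitian _ _ _) fun x => ?_
  have h1 : star x ⬝ᵥ (rankOneUpdate A (fun i => √(a i) * √(r i)) r *ᵥ x) =
      ∑ i, r i * x i ^ 2 - A⁻¹ * (∑ i, √(a i) * (√(r i) * x i)) ^ 2 := by
    simp only [dotProduct, rankOneUpdate_mulVec, star_trivial, mul_sub, Finset.sum_sub_distrib,
      sq, Finset.mul_sum, Finset.sum_mul]
    congr 1
    · exact Finset.sum_congr rfl fun i _ => by ring
    · exact Finset.sum_congr rfl fun i _ => Finset.sum_congr rfl fun j _ => by ring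
  rw [h1, sub_nonneg, inv_mul_le_iff₀ hA]
  have h2 := Finset.sum_mul_sq_le_sq_mul_sq Finset.univ (fun i => √(a i))
    (fun i => √(r i) * x i)
  simp only [mul_pow, Real.sq_sqrt (ha _), Real.sq_sqrt (hr _)] at h2
  exact h2.trans (mul_le_mul_of_nonneg_right hsum
    (Finset.sum_nonneg fun i _ => mul_nonneg (hr i) (sq_nonneg _)))

/-- With `R = diag r` and `w = √(a r)`, the function equals `A - wᵀ (p + R)⁻¹ w`. By the Woodbury
identity its reciprocal is `A⁻¹ + A⁻² wᵀ (p + R - w wᵀ / A)⁻¹ w`. Diagonalising the symmetric matrix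
`R - w wᵀ / A` gives the partial fractions: `d` are its eigenvalues, nonnegative by
semidefiniteness, and `c` the coordinates of `w` in its eigenbasis. -/
theorem finiteBernstein_inv_eq {n : ℕ} {A₀ : ℝ} (hA₀ : 0 < A₀) {a r : Fin n → ℝ}
    (ha : ∀ i, 0 ≤ a i) (hr : ∀ i, 0 ≤ r i) :
    ∃ A : ℝ, 0 < A ∧ ∃ c d : Fin n → ℝ, (∀ k, 0 ≤ d k) ∧ ∀ p : ℂ, 0 < p.re →
      (finiteBernstein A₀ a r p)⁻¹ =
        ((A⁻¹ : ℝ) : ℂ) + ∑ k, (((c k / A) ^ 2 : ℝ) : ℂ) * (p + (d k : ℂ))⁻¹ := by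
  set A := A₀ + ∑ i, a i with hAdef
  have hsum : 0 ≤ ∑ i, a i := Finset.sum_nonneg fun i _ => ha i
  have hA : 0 < A := by linarith
  set w : Fin n → ℝ := fun i => √(a i) * √(r i) with hw
  have hM := rankOneUpdate_posSemidef hA ha hr (by linarith)
  set b := hM.isHermitian.eigenvectorBasis with hb
  set d := hM.isHermitian.eigenvalues with hd
  set c : Fin n → ℝ := fun k => ∑ i, w i * b k i with hc
  have hww : ∀ i, w i * w i = a i * r i := by
    intro i
    have h1 := Real.mul_self_sqrt (ha i)
    have h2 := Real.mul_self_sqrt (hr i)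
    calc w i * w i = (√(a i) * √(a i)) * (√(r i) * √(r i)) := by simp only [hw]; ring
      _ = a i * r i := by rw [h1, h2]
  have hexp : ∀ i, w i = ∑ k, c k * b k i := by
    intro i
    have h := congrArg (fun v : EuclideanSpace ℝ (Fin n) => v i)
      (b.sum_repr (WithLp.toLp 2 w))
    simp only [b.repr_apply_apply] at h
    refine h.symm.trans ?_
    simp [hc, PiLp.inner_apply]
  have heig : ∀ k i, r i * b k i - A⁻¹ * (w i * c k) = d k * b k i := by
    intro k i
    have h := congrFun (hM.isHermitian.mulVec_eigenvectorBasis k) i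
    rw [rankOneUpdate_mulVec] at h
    simpa using h
  refine ⟨A, hA, c, d, fun k => hM.eigenvalues_nonneg k, fun p hp => ?_⟩
  have hpr : ∀ i, p + (r i : ℂ) ≠ 0 := fun i => add_ofReal_ne_zero hp (hr i)
  have hpd : ∀ k, p + (d k : ℂ) ≠ 0 := fun k => add_ofReal_ne_zero hp (hM.eigenvalues_nonneg k)
  have hAc : (A : ℂ) ≠ 0 := by exact_mod_cast hA.ne'
  -- Here `y = (p + R)⁻¹ w` and `s = wᵀ y`. Pairing `(p + R) y = w` with each eigenvector replaces
  -- an explicit resolvent.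
  set y : Fin n → ℂ := fun i => w i / (p + r i) with hy
  have hyi : ∀ i, y i * (p + r i) = w i := fun i => div_mul_cancel₀ _ (hpr i)
  set s : ℂ := ∑ i, w i * y i with hs
  have hQ : finiteBernstein A₀ a r p = A - s := by
    rw [finiteBernstein, hAdef, hs]
    push_cast
    rw [add_sub_assoc, ← Finset.sum_sub_distrib]
    congr 1
    refine Finset.sum_congr rfl fun i _ => ?_
    have h := hww i
    have : (w i : ℂ) * w i = a i * r i := by exact_mod_cast h
    simp only [hy]
    have h3 := hpr i
    rw [← mul_div_assoc, ← mul_div_assoc, this]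
    field_simp
    ring
  have hQ0 : (A : ℂ) - s ≠ 0 := by
    rw [← hQ]
    intro h
    have := le_re_finiteBernstein (A₀ := A₀) ha hr hp
    rw [h] at this
    simp at this
    linarith
  have hproj : ∀ k, (∑ i, (b k i : ℂ) * y i) * (p + d k) = c k * (1 - s / A) := by
    intro k
    have e1 : (∑ i, (b k i : ℂ) * y i) * (p + d k) =
        ∑ i, ((b k i : ℂ) * w i - (c k / A) * (w i * y i)) := by
      rw [Finset.sum_mul]
      refine Finset.sum_congr rfl fun i _ => ?_
      have h := heig k i
      have h' : (d k : ℂ) * b k i = r i * b k i - (A : ℂ)⁻¹ * (w i * c k) := by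
        exact_mod_cast h.symm
      have : (b k i : ℂ) * y i * (p + d k) = b k i * y i * p + (d k * b k i) * y i := by ring
      rw [this, h']
      linear_combination (b k i : ℂ) * hyi i
    rw [e1, Finset.sum_sub_distrib, ← Finset.mul_sum, ← hs]
    have : ∑ i, (b k i : ℂ) * w i = c k := by
      simp only [hc]; push_cast
      exact Finset.sum_congr rfl fun i _ => mul_comm _ _
    rw [this]; ring
  have hsF : s = (1 - s / A) * ∑ k, ((c k : ℂ)) ^ 2 * (p + d k)⁻¹ := by
    calc s = ∑ i, ∑ k, ((c k : ℂ) * b k i) * y i := by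
          rw [hs]
          refine Finset.sum_congr rfl fun i _ => ?_
          rw [← Finset.sum_mul]
          congr 1
          exact_mod_cast hexp i
      _ = ∑ k, (c k : ℂ) * ∑ i, (b k i : ℂ) * y i := by
          rw [Finset.sum_comm]
          refine Finset.sum_congr rfl fun k _ => ?_
          rw [Finset.mul_sum]
          exact Finset.sum_congr rfl fun i _ => by ring
      _ = _ := by
          rw [Finset.mul_sum]
          refine Finset.sum_congr rfl fun k _ => ?_
          rw [(eq_mul_inv_iff_mul_eq₀ (hpd k)).2 (hproj k)]
          ring
  have hF : ∑ k, (((c k / A) ^ 2 : ℝ) : ℂ) * (p + (d k : ℂ))⁻¹ =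
      (∑ k, ((c k : ℂ)) ^ 2 * (p + d k)⁻¹) / (A : ℂ) ^ 2 := by
    rw [Finset.sum_div]
    refine Finset.sum_congr rfl fun k _ => ?_
    push_cast
    ring
  rw [hQ, hF]
  set F := ∑ k, ((c k : ℂ)) ^ 2 * (p + d k)⁻¹
  have hs2 : s * A = (A - s) * F := by
    calc s * A = ((1 - s / A) * F) * A := by rw [← hsF]
      _ = (A - s) * F := by field_simp
  push_cast
  have hF2 : F = s * A / (A - s) := by rw [hs2]; field_simp
  rw [hF2]
  field_simp
  ring

end RankOneUpdate

theorem isStieltjes_finiteBernstein_inv {n : ℕ} {A₀ : ℝ} (hA₀ : 0 < A₀) {a r : Fin n → ℝ}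
    (ha : ∀ i, 0 ≤ a i) (hr : ∀ i, 0 ≤ r i) :
    IsStieltjes fun p => (finiteBernstein A₀ a r p)⁻¹ := by
  obtain ⟨A, hA, c, d, hd, h⟩ := finiteBernstein_inv_eq hA₀ ha hr
  refine ((isStieltjes_const (inv_nonneg.2 hA.le)).add (IsStieltjes.sum Finset.univ
    fun k _ => (isStieltjes_inv_add (hd k)).const_mul (sq_nonneg (c k / A)))).congr h

/-! ### Difference operators and complete monotonicity -/

/-- Translation by `h`, as a linear operator on real functions. -/
def shiftOp (h : ℝ) : Module.End ℝ (ℝ → ℝ) where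
  toFun f t := f (t + h)
  map_add' _ _ := rfl
  map_smul' _ _ := rfl

theorem shiftOp_apply (h : ℝ) (f : ℝ → ℝ) (t : ℝ) : shiftOp h f t = f (t + h) := rfl

theorem shiftOp_pow_apply (h : ℝ) (n : ℕ) (f : ℝ → ℝ) (t : ℝ) :
    (shiftOp h ^ n) f t = f (t + n * h) := by
  induction n generalizing t with
  | zero => simp
  | succ n ih =>
    rw [pow_succ', Module.End.mul_apply, shiftOp_apply, ih]
    push_cast
    congr 1
    ring

/-- The backward-signed difference operator `f ↦ f - f (· + h)`. -/
def decrement (h : ℝ) : Module.End ℝ (ℝ → ℝ) := 1 - shiftOp h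

/-- Binomial expansion of `1 = (T + (1 - T)) ^ m`, where `T` is the shift. -/
theorem sum_choose_shiftOp_decrement (h : ℝ) (m : ℕ) (f : ℝ → ℝ) (t : ℝ) :
    ∑ i ∈ Finset.range (m + 1), (m.choose i : ℝ) * (decrement h ^ (m - i)) f (t + i * h) = f t := by
  have hc : Commute (shiftOp h) (decrement h) :=
    (Commute.one_right _).sub_right (Commute.refl _)
  have h1 := hc.add_pow m
  rw [decrement, add_sub_cancel, one_pow, ← decrement] at h1
  have h2 := congrFun (congrArg (fun T : Module.End ℝ (ℝ → ℝ) => T f) h1) t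
  simp only [Module.End.one_apply, LinearMap.sum_apply, Finset.sum_apply] at h2
  rw [h2]
  refine Finset.sum_congr rfl fun i _ => ?_
  rw [← Nat.cast_comm, Module.End.mul_apply, Module.End.mul_apply]
  have : ((m.choose i : ℕ) : Module.End ℝ (ℝ → ℝ)) = (m.choose i : ℝ) • 1 := by
    rw [Nat.cast_smul_eq_nsmul, nsmul_one]
  rw [this, LinearMap.smul_apply, Module.End.one_apply, Pi.smul_apply, smul_eq_mul,
    shiftOp_pow_apply]

namespace IsCompletelyMonotone

variable {f : ℝ → ℝ}

theorem nonneg (hf : IsCompletelyMonotone f) {x : ℝ} (hx : 0 < x) : 0 ≤ f x := by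
  simpa using hf.2 0 x hx

theorem contDiffAt (hf : IsCompletelyMonotone f) {x : ℝ} (hx : 0 < x) :
    ContDiffAt ℝ (⊤ : ℕ∞) f x :=
  hf.1.contDiffAt (isOpen_Ioi.mem_nhds hx)

theorem iteratedDeriv_nonneg (hf : IsCompletelyMonotone f) (n : ℕ) {x : ℝ} (hx : 0 < x) :
    0 ≤ (-1 : ℝ) ^ n * iteratedDeriv n f x := by
  rw [← iteratedDerivWithin_of_isOpen (isOpen_Ioi (a := (0 : ℝ))) hx]
  exact hf.2 n x hx

theorem of_iteratedDeriv_nonneg (hf : ContDiffOn ℝ (⊤ : ℕ∞) f (Ioi 0))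
    (h : ∀ (n : ℕ) (x : ℝ), 0 < x → 0 ≤ (-1 : ℝ) ^ n * iteratedDeriv n f x) :
    IsCompletelyMonotone f := by
  refine ⟨hf, fun n x hx => ?_⟩
  rw [iteratedDerivWithin_of_isOpen (isOpen_Ioi (a := (0 : ℝ))) hx]
  exact h n x hx

theorem antitoneOn_iteratedDeriv (hf : IsCompletelyMonotone f) (n : ℕ) :
    AntitoneOn (fun x => (-1 : ℝ) ^ n * iteratedDeriv n f x) (Ioi 0) := by
  have hd : ∀ x : ℝ, 0 < x → HasDerivAt (fun x => (-1 : ℝ) ^ n * iteratedDeriv n f x)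
      ((-1 : ℝ) ^ n * iteratedDeriv (n + 1) f x) x := by
    intro x hx
    refine HasDerivAt.const_mul _ ?_
    rw [iteratedDeriv_succ]
    refine DifferentiableAt.hasDerivAt ?_
    have h1 : DifferentiableOn ℝ (iteratedDerivWithin n f (Ioi 0)) (Ioi 0) :=
      hf.1.differentiableOn_iteratedDerivWithin (by exact_mod_cast WithTop.coe_lt_top n)
        isOpen_Ioi.uniqueDiffOn
    refine (h1.differentiableAt (isOpen_Ioi.mem_nhds hx)).congr_of_eventuallyEq ?_
    filter_upwards [isOpen_Ioi.mem_nhds hx] with y hy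
    exact (iteratedDerivWithin_of_isOpen isOpen_Ioi hy).symm
  refine antitoneOn_of_deriv_nonpos (convex_Ioi 0)
    (fun x hx => (hd x hx).continuousAt.continuousWithinAt)
    (fun x hx => (hd x (by simpa using hx)).differentiableAt.differentiableWithinAt)
    fun x hx => ?_
  have hx' : 0 < x := by simpa using hx
  rw [(hd x hx').deriv]
  have := hf.iteratedDeriv_nonneg (n + 1) hx'
  rw [pow_succ] at this
  linarith

theorem antitoneOn (hf : IsCompletelyMonotone f) : AntitoneOn f (Ioi 0) := by
  simpa using hf.antitoneOn_iteratedDeriv 0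

theorem decrement {h : ℝ} (hf : IsCompletelyMonotone f) (hh : 0 ≤ h) :
    IsCompletelyMonotone (decrement h f) := by
  have hmaps : ∀ x : ℝ, 0 < x → 0 < x + h := fun x hx => by linarith
  have hs : ContDiffOn ℝ (⊤ : ℕ∞) (fun t => f (t + h)) (Ioi 0) :=
    hf.1.comp (by fun_prop) fun x hx => hmaps x hx
  refine of_iteratedDeriv_nonneg (hf.1.sub hs) fun n x hx => ?_
  have h1 : iteratedDeriv n (_root_.decrement h f) x =
      iteratedDeriv n f x - iteratedDeriv n f (x + h) := by
    have h2 := iteratedDeriv_fun_sub (n := n) (x := x) (f := f) (g := fun t => f (t + h))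
      ((hf.contDiffAt hx).of_le (by exact_mod_cast le_top))
      (((hs.contDiffAt (isOpen_Ioi.mem_nhds hx))).of_le (by exact_mod_cast le_top))
    rw [iteratedDeriv_comp_add_const] at h2
    exact h2
  rw [h1, mul_sub, sub_nonneg]
  exact hf.antitoneOn_iteratedDeriv n hx (hmaps x hx) (by linarith)

theorem decrement_pow {h : ℝ} (hf : IsCompletelyMonotone f) (hh : 0 ≤ h) (m : ℕ) :
    IsCompletelyMonotone ((_root_.decrement h ^ m) f) := by
  induction m with
  | zero => simpa using hf
  | succ m ih =>
    rw [pow_succ', Module.End.mul_apply]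
    exact ih.decrement hh

/-- Removing the limit before approximating lets it survive as the constant term of every
approximant, which bounds the real parts below uniformly. -/
theorem sub_const (hf : IsCompletelyMonotone f) {c : ℝ} (hc : Tendsto f atTop (𝓝 c)) :
    IsCompletelyMonotone fun t => f t - c := by
  refine of_iteratedDeriv_nonneg (hf.1.sub contDiffOn_const) fun n x hx => ?_
  rcases Nat.eq_zero_or_pos n with rfl | hn
  · simp only [pow_zero, iteratedDeriv_zero, one_mul, sub_nonneg]
    refine le_of_tendsto hc ?_
    filter_upwards [eventually_ge_atTop x] with y hy
    exact hf.antitoneOn hx (hx.trans_le hy) hy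
  · rw [iteratedDeriv_fun_sub ((hf.contDiffAt hx).of_le (by exact_mod_cast le_top))
      contDiffAt_const, iteratedDeriv_const, if_neg hn.ne', sub_zero]
    exact hf.iteratedDeriv_nonneg n hx

end IsCompletelyMonotone

/-! ### Approximation by sums of exponentials -/

/-- The weight at `j / n` of the Hausdorff moment approximation of `k ↦ f (t + k h)`. -/
noncomputable def hausdorffWeight (f : ℝ → ℝ) (t h : ℝ) (n j : ℕ) : ℝ :=
  (n.choose j : ℝ) * (decrement h ^ (n - j)) f (t + j * h)

theorem IsCompletelyMonotone.hausdorffWeight_nonneg {f : ℝ → ℝ} (hf : IsCompletelyMonotone f)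
    {t h : ℝ} (ht : 0 < t) (hh : 0 ≤ h) (n j : ℕ) : 0 ≤ hausdorffWeight f t h n j :=
  mul_nonneg (Nat.cast_nonneg _) ((hf.decrement_pow hh _).nonneg (by positivity))

/-- The weights have exact binomial moments: `C(n,j) C(j,k) = C(n,k) C(n-k,j-k)` reduces the sum to
the expansion of `1 = (T + (1 - T)) ^ (n - k)`. -/
theorem sum_hausdorffWeight_mul_choose (f : ℝ → ℝ) (t h : ℝ) {n k : ℕ} (hk : k ≤ n) :
    ∑ j ∈ Finset.range (n + 1), hausdorffWeight f t h n j * (j.choose k : ℝ) =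
      n.choose k * f (t + k * h) := by
  obtain ⟨m, rfl⟩ := Nat.exists_eq_add_of_le hk
  rw [add_assoc, Finset.sum_range_add, Finset.sum_eq_zero, zero_add,
    ← sum_choose_shiftOp_decrement h m f (t + k * h), Finset.mul_sum]
  · refine Finset.sum_congr rfl fun i _ => ?_
    have h1 : (((k + m).choose (k + i) : ℕ) : ℝ) * ((k + i).choose k : ℕ) =
        ((k + m).choose k : ℕ) * (m.choose i : ℕ) := by
      have := Nat.choose_mul (n := k + m) (k := k + i) (s := k) (by omega)
      rw [Nat.add_sub_cancel_left, Nat.add_sub_cancel_left] at this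
      exact_mod_cast this
    have h2 : t + ((k + i : ℕ) : ℝ) * h = t + k * h + i * h := by push_cast; ring
    rw [hausdorffWeight, Nat.add_sub_add_left, h2, mul_right_comm, h1]
    ring
  · intro j hj
    rw [Nat.choose_eq_zero_of_lt (Finset.mem_range.1 hj)]
    simp

theorem sum_hausdorffWeight (f : ℝ → ℝ) (t h : ℝ) (n : ℕ) :
    ∑ j ∈ Finset.range (n + 1), hausdorffWeight f t h n j = f t := by
  simpa using sum_hausdorffWeight_mul_choose f t h (Nat.zero_le n)

theorem choose_div_choose_succ {n j k : ℕ} :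
    (j.choose (k + 1) : ℝ) / n.choose (k + 1) =
      ((j - k : ℕ) : ℝ) / (n - k : ℕ) * ((j.choose k : ℝ) / n.choose k) := by
  have h1 := Nat.choose_succ_right_eq j k
  have h2 := Nat.choose_succ_right_eq n k
  have hk : ((k + 1 : ℕ) : ℝ) ≠ 0 := by positivity
  have h1' : (j.choose (k + 1) : ℝ) * (k + 1 : ℕ) = j.choose k * (j - k : ℕ) := by exact_mod_cast h1
  have h2' : (n.choose (k + 1) : ℝ) * (k + 1 : ℕ) = n.choose k * (n - k : ℕ) := by exact_mod_cast h2
  rw [← mul_div_mul_right _ _ hk, h1', h2', mul_div_mul_comm, mul_comm]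

theorem abs_div_sub_div_le {n j k K : ℕ} (hj : j ≤ n) (hk : k ≤ K) (hK : K < n) :
    |(j : ℝ) / n - ((j - k : ℕ) : ℝ) / (n - k : ℕ)| ≤ (K : ℝ) / (n - K : ℕ) := by
  have hkn : k < n := hk.trans_lt hK
  have e1 : ((n - k : ℕ) : ℝ) = n - k := Nat.cast_sub hkn.le
  have hn : (0 : ℝ) < n := by exact_mod_cast (Nat.zero_le k).trans_lt hkn
  have hnk : (0 : ℝ) < n - k := by rw [← e1]; exact_mod_cast Nat.sub_pos_of_lt hkn
  have hjn : (j : ℝ) ≤ n := by exact_mod_cast hj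
  have hk0 : (0 : ℝ) ≤ k := Nat.cast_nonneg k
  have hj0 : (0 : ℝ) ≤ j := Nat.cast_nonneg j
  have hmain : |(j : ℝ) / n - ((j - k : ℕ) : ℝ) / (n - k : ℕ)| ≤ (k : ℝ) / (n - k : ℕ) := by
    rw [e1]
    rcases le_total k j with h | h
    · rw [Nat.cast_sub h]
      have : (j : ℝ) / n - ((j : ℝ) - k) / (n - k) = (k / (n - k)) * ((n - j) / n) := by
        field_simp
        ring
      rw [this, abs_of_nonneg (mul_nonneg (by positivity) (div_nonneg (by linarith) hn.le))]
      refine mul_le_of_le_one_right (by positivity) ?_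
      rw [div_le_one hn]
      linarith
    · rw [Nat.sub_eq_zero_of_le h, Nat.cast_zero, zero_div, sub_zero, abs_of_nonneg (by positivity)]
      have hjk : (j : ℝ) ≤ k := by exact_mod_cast h
      exact div_le_div₀ hk0 hjk hnk (by linarith)
  refine hmain.trans (div_le_div₀ (Nat.cast_nonneg _) (by exact_mod_cast hk) ?_ ?_)
  · exact_mod_cast Nat.sub_pos_of_lt hK
  · exact_mod_cast Nat.sub_le_sub_left hk n

theorem choose_div_choose_le_one {n j : ℕ} (hj : j ≤ n) (k : ℕ) :
    (j.choose k : ℝ) / n.choose k ≤ 1 :=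
  div_le_one_of_le₀ (by exact_mod_cast Nat.choose_le_choose k hj) (Nat.cast_nonneg _)

/-- The ratio of binomials is a product of `k` factors `(j - i) / (n - i)`, each within `K / (n -
K)` of `j / n`. As everything lies in `[0, 1]`, the errors add up. -/
theorem abs_pow_sub_choose_div_choose_le {n j K : ℕ} (hj : j ≤ n) (hK : K < n) :
    ∀ k ≤ K, |((j : ℝ) / n) ^ k - (j.choose k : ℝ) / n.choose k| ≤
      k * ((K : ℝ) / (n - K : ℕ)) := by
  intro k
  induction k with
  | zero => simp
  | succ k ih =>
    intro hk
    have hk' : k ≤ K := (Nat.le_succ k).trans hk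
    have h1 := ih hk'
    have h2 := abs_div_sub_div_le hj hk' hK
    have hx0 : 0 ≤ (j : ℝ) / n := by positivity
    have hx1 : (j : ℝ) / n ≤ 1 := div_le_one_of_le₀ (by exact_mod_cast hj) (Nat.cast_nonneg _)
    have hR0 : 0 ≤ (j.choose k : ℝ) / n.choose k := by positivity
    have hR1 := choose_div_choose_le_one hj k
    rw [choose_div_choose_succ]
    set x := (j : ℝ) / n
    set R := (j.choose k : ℝ) / n.choose k
    set q := ((j - k : ℕ) : ℝ) / (n - k : ℕ)
    have e : x ^ (k + 1) - q * R = x * (x ^ k - R) + R * (x - q) := by ring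
    calc |x ^ (k + 1) - q * R| ≤ |x * (x ^ k - R)| + |R * (x - q)| := by
          rw [e]; exact abs_add_le _ _
      _ ≤ |x ^ k - R| + |x - q| := by
          rw [abs_mul, abs_mul, abs_of_nonneg hx0, abs_of_nonneg hR0]
          exact add_le_add (mul_le_of_le_one_left (abs_nonneg _) hx1)
            (mul_le_of_le_one_left (abs_nonneg _) hR1)
      _ ≤ k * ((K : ℝ) / (n - K : ℕ)) + (K : ℝ) / (n - K : ℕ) := add_le_add h1 h2
      _ = ((k + 1 : ℕ) : ℝ) * ((K : ℝ) / (n - K : ℕ)) := by push_cast; ring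

theorem IsCompletelyMonotone.abs_sum_hausdorffWeight_sub_le {f : ℝ → ℝ}
    (hf : IsCompletelyMonotone f) {t h : ℝ} (ht : 0 < t) (hh : 0 ≤ h) {n k K : ℕ} (hk : k ≤ K)
    (hK : K < n) :
    |∑ j ∈ Finset.range (n + 1), hausdorffWeight f t h n j * ((j : ℝ) / n) ^ k - f (t + k * h)| ≤
      f t * (K * ((K : ℝ) / (n - K : ℕ))) := by
  have hkn : k ≤ n := hk.trans hK.le
  have hc : (n.choose k : ℝ) ≠ 0 := by exact_mod_cast (Nat.choose_pos hkn).ne'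
  have e : f (t + k * h) = ∑ j ∈ Finset.range (n + 1),
      hausdorffWeight f t h n j * ((j.choose k : ℝ) / n.choose k) := by
    simp_rw [← mul_div_assoc]
    rw [← Finset.sum_div, sum_hausdorffWeight_mul_choose f t h hkn, mul_div_cancel_left₀ _ hc]
  rw [e, ← Finset.sum_sub_distrib]
  refine (Finset.abs_sum_le_sum_abs _ _).trans ?_
  rw [← sum_hausdorffWeight f t h n, Finset.sum_mul]
  refine Finset.sum_le_sum fun j hj => ?_
  rw [← mul_sub, abs_mul, abs_of_nonneg (hf.hausdorffWeight_nonneg ht hh n j)]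
  refine mul_le_mul_of_nonneg_left ?_ (hf.hausdorffWeight_nonneg ht hh n j)
  refine (abs_pow_sub_choose_div_choose_le (Nat.lt_succ_iff.1 (Finset.mem_range.1 hj)) hK k
    hk).trans ?_
  gcongr

/-- A finite sum of decaying exponentials. -/
noncomputable def expSum {n : ℕ} (a r : Fin n → ℝ) (s : ℝ) : ℝ :=
  ∑ i, a i * Real.exp (-r i * s)

theorem expSum_nonneg {n : ℕ} {a : Fin n → ℝ} (ha : ∀ i, 0 ≤ a i) (r : Fin n → ℝ) (s : ℝ) :
    0 ≤ expSum a r s :=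
  Finset.sum_nonneg fun i _ => mul_nonneg (ha i) (Real.exp_pos _).le

theorem antitone_expSum {n : ℕ} {a r : Fin n → ℝ} (ha : ∀ i, 0 ≤ a i) (hr : ∀ i, 0 ≤ r i) :
    Antitone (expSum a r) := fun s t hst =>
  Finset.sum_le_sum fun i _ => mul_le_mul_of_nonneg_left
    (Real.exp_le_exp.2 (by nlinarith [hr i])) (ha i)

/-- A node `j / n` becomes the rate `-log (j / n) / h`. The node `j = 0` would have infinite rate
and is dropped. It contributes only to the moment `k = 0`, which is why the lower bound needs `1 ≤
k`. -/
theorem IsCompletelyMonotone.exists_expSum_grid {f : ℝ → ℝ} (hf : IsCompletelyMonotone f)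
    {t h δ : ℝ} (ht : 0 < t) (hh : 0 < h) (hδ : 0 < δ) (K : ℕ) :
    ∃ (n : ℕ) (a r : Fin n → ℝ), (∀ i, 0 ≤ a i) ∧ (∀ i, 0 ≤ r i) ∧
      ∀ k ≤ K, expSum a r (k * h) ≤ f (t + k * h) + δ ∧
        (1 ≤ k → f (t + k * h) - δ ≤ expSum a r (k * h)) := by
  have hlim : Tendsto (fun m : ℕ => f t * (K * ((K : ℝ) / (m : ℕ)))) atTop
      (𝓝 (f t * (K * 0))) :=
    ((tendsto_const_div_atTop_nhds_zero_nat (K : ℝ)).const_mul _).const_mul _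
  rw [mul_zero, mul_zero] at hlim
  obtain ⟨m, hm, hm1⟩ := ((hlim.eventually (gt_mem_nhds hδ)).and (eventually_ge_atTop 1)).exists
  set n := m + K with hn
  have hKn : K < n := by omega
  have hn0 : (0 : ℝ) < n := by exact_mod_cast (Nat.zero_le K).trans_lt hKn
  have hmn : n - K = m := by omega
  refine ⟨n, fun i => hausdorffWeight f t h n (i + 1),
    fun i => -Real.log (((i + 1 : ℕ) : ℝ) / n) / h,
    fun i => hf.hausdorffWeight_nonneg ht hh.le _ _, fun i => ?_, fun k hk => ?_⟩
  · refine div_nonneg (neg_nonneg.2 (Real.log_nonpos (by positivity) ?_)) hh.le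
    exact div_le_one_of_le₀ (by exact_mod_cast i.2) hn0.le
  have h1 := hf.abs_sum_hausdorffWeight_sub_le ht hh.le hk hKn
  rw [hmn] at h1
  have h2 := abs_le.1 (h1.trans hm.le)
  have e : expSum (fun i : Fin n => hausdorffWeight f t h n (i + 1))
      (fun i => -Real.log (((i + 1 : ℕ) : ℝ) / n) / h) (k * h) =
      ∑ j ∈ Finset.range n, hausdorffWeight f t h n (j + 1) * (((j + 1 : ℕ) : ℝ) / n) ^ k := by
    rw [expSum, ← Fin.sum_univ_eq_sum_range
      (fun j => hausdorffWeight f t h n (j + 1) * (((j + 1 : ℕ) : ℝ) / n) ^ k)]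
    refine Finset.sum_congr rfl fun i _ => ?_
    congr 1
    rw [← Real.rpow_natCast, Real.rpow_def_of_pos (by positivity)]
    congr 1
    field_simp
  rw [e]
  rw [Finset.sum_range_succ'] at h2
  have h0 := mul_nonneg (hf.hausdorffWeight_nonneg ht hh.le n 0)
    (pow_nonneg (by positivity : (0 : ℝ) ≤ ((0 : ℕ) : ℝ) / n) k)
  refine ⟨by linarith [h2.2], fun hk1 => ?_⟩
  have h0' : (((0 : ℕ) : ℝ) / n) ^ k = 0 := by simp; omega
  rw [h0', mul_zero] at h2
  linarith [h2.1]

/-- Monotonicity of both sides carries the estimate from the grid to all `s > 0`. The uniform bound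
serves as a majorant for dominated convergence. -/
theorem IsCompletelyMonotone.exists_expSum_tendsto {f : ℝ → ℝ} (hf : IsCompletelyMonotone f) :
    ∃ (n : ℕ → ℕ) (a r : ∀ N, Fin (n N) → ℝ), (∀ N i, 0 ≤ a N i) ∧ (∀ N i, 0 ≤ r N i) ∧
      (∀ N, ∀ s : ℝ, 0 < s → expSum (a N) (r N) s ≤ f s + f 1 + 1) ∧
      ∀ s : ℝ, 0 < s → Tendsto (fun N => expSum (a N) (r N) s) atTop (𝓝 (f s)) := by
  set h : ℕ → ℝ := fun N => 1 / ((N : ℝ) + 1) with hdef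
  have hpos : ∀ N, 0 < h N := fun N => by positivity
  have hle : ∀ N, h N ≤ 1 := fun N =>
    div_le_one_of_le₀ (by linarith [Nat.cast_nonneg (α := ℝ) N]) (by positivity)
  have hlim : Tendsto h atTop (𝓝 0) := tendsto_one_div_add_atTop_nhds_zero_nat
  -- Starting at `h N` instead of `0` avoids a possible singularity of `f`. With `(N + 1) ^ 2` steps
  -- of length `1 / (N + 1)` the grid reaches `N + 1`.
  choose n a r ha hr hg using fun N : ℕ =>
    hf.exists_expSum_grid (hpos N) (hpos N) (hpos N) ((N + 1) ^ 2)
  have hKh : ∀ N : ℕ, (((N + 1) ^ 2 : ℕ) : ℝ) * h N = N + 1 := fun N => by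
    simp only [hdef]
    push_cast
    field_simp
  have hfl : ∀ N s, 0 < s → (⌊s / h N⌋₊ : ℝ) * h N ≤ s := fun N s hs => by
    rw [← le_div_iff₀ (hpos N)]
    exact Nat.floor_le (div_pos hs (hpos N)).le
  have hfl' : ∀ N s, 0 < s → s ≤ h N + (⌊s / h N⌋₊ : ℝ) * h N := fun N s hs => by
    have := (Nat.lt_floor_add_one (s / h N)).le
    rw [div_le_iff₀ (hpos N)] at this
    linarith
  have hup : ∀ N s, 0 < s → ⌊s / h N⌋₊ ≤ (N + 1) ^ 2 →
      expSum (a N) (r N) s ≤ f s + h N := fun N s hs hk =>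
    calc expSum (a N) (r N) s ≤ expSum (a N) (r N) (⌊s / h N⌋₊ * h N) :=
          antitone_expSum (ha N) (hr N) (hfl N s hs)
      _ ≤ f (h N + ⌊s / h N⌋₊ * h N) + h N := (hg N _ hk).1
      _ ≤ f s + h N :=
          add_le_add_left (hf.antitoneOn hs (hs.trans_le (hfl' N s hs)) (hfl' N s hs)) _
  refine ⟨n, a, r, ha, hr, fun N s hs => ?_, fun s hs => ?_⟩
  · have hf1 := hf.nonneg one_pos
    have hfs := hf.nonneg hs
    rcases le_total ⌊s / h N⌋₊ ((N + 1) ^ 2) with hk | hk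
    · linarith [hup N s hs hk, hle N]
    · have h1 : (((N + 1) ^ 2 : ℕ) : ℝ) * h N ≤ s :=
        (mul_le_mul_of_nonneg_right (by exact_mod_cast hk) (hpos N).le).trans (hfl N s hs)
      have h2 := antitone_expSum (ha N) (hr N) h1
      have h3 := (hg N _ le_rfl).1
      have h4 : 1 ≤ h N + (((N + 1) ^ 2 : ℕ) : ℝ) * h N := by
        rw [hKh]; linarith [hpos N, Nat.cast_nonneg (α := ℝ) N]
      have h5 := hf.antitoneOn (mem_Ioi.2 one_pos) (mem_Ioi.2 (one_pos.trans_le h4)) h4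
      linarith [hle N]
  · have hev : ∀ᶠ N : ℕ in atTop, ⌊s / h N⌋₊ + 1 ≤ (N + 1) ^ 2 := by
      obtain ⟨M, hM⟩ := exists_nat_ge s
      filter_upwards [eventually_ge_atTop M] with N hN
      have h1 : s / h N < ((N + 1) ^ 2 : ℕ) := by
        rw [div_lt_iff₀ (hpos N), hKh]
        have : (M : ℝ) ≤ N := by exact_mod_cast hN
        linarith
      exact (Nat.floor_lt (div_pos hs (hpos N)).le).2 h1
    -- One `h N` is the offset of the grid, the other comes from rounding `s` up to the next grid
    -- point.
    have hlow : Tendsto (fun N => f (s + 2 * h N) - h N) atTop (𝓝 (f s)) := by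
      have h1 : Tendsto (fun N => s + 2 * h N) atTop (𝓝 s) := by
        simpa using (hlim.const_mul 2).const_add s
      simpa using ((hf.contDiffAt hs).continuousAt.tendsto.comp h1).sub hlim
    have hhigh : Tendsto (fun N => f s + h N) atTop (𝓝 (f s)) := by
      simpa using hlim.const_add (f s)
    refine tendsto_of_tendsto_of_tendsto_of_le_of_le' hlow hhigh ?_ ?_
    · filter_upwards [hev] with N hN
      have h1 := (hg N _ hN).2 (by omega)
      have h2 : s ≤ ((⌊s / h N⌋₊ + 1 : ℕ) : ℝ) * h N := by
        push_cast
        linarith [hfl' N s hs]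
      have h3 := antitone_expSum (ha N) (hr N) h2
      have h4 : h N + ((⌊s / h N⌋₊ + 1 : ℕ) : ℝ) * h N ≤ s + 2 * h N := by
        push_cast
        linarith [hfl N s hs]
      have h5 := hf.antitoneOn (mem_Ioi.2 ((hpos N).trans_le (by linarith)))
        (mem_Ioi.2 (by linarith [hpos N])) h4
      linarith
    · filter_upwards [hev] with N hN
      exact hup N s hs (by omega)

/-! ### Laplace transforms and the modulus `Q` -/

theorem norm_exp_neg_mul_ofReal (p : ℂ) (t : ℝ) :
    ‖Complex.exp (-p * t)‖ = Real.exp (-p.re * t) := by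
  rw [Complex.norm_exp]
  simp

theorem integrableOn_exp_neg_mul {p : ℂ} (hp : 0 < p.re) :
    IntegrableOn (fun t : ℝ => Complex.exp (-p * t)) (Ioi 0) :=
  integrableOn_exp_mul_complex_Ioi (by simpa using hp) 0

theorem integral_exp_neg_mul {p : ℂ} (hp : 0 < p.re) :
    ∫ t in Ioi (0 : ℝ), Complex.exp (-p * t) = p⁻¹ := by
  rw [integral_exp_mul_complex_Ioi (by simpa using hp) 0]
  simp [neg_div_neg_eq]

theorem IsLICM.integrableOn_mul_exp {G : ℝ → ℝ} (hG : IsLICM G) {p : ℂ} (hp : 0 < p.re) :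
    IntegrableOn (fun t : ℝ => (G t : ℂ) * Complex.exp (-p * t)) (Ioi 0) := by
  have hcont : ContinuousOn G (Ioi 0) := hG.1.1.continuousOn
  rw [← Ioc_union_Ioi_eq_Ioi zero_le_one]
  refine IntegrableOn.union ?_ ?_
  · have h1 : IntegrableOn G (Ioc 0 1) :=
      (hG.2.integrableOn_compact_subset Icc_subset_Ici_self isCompact_Icc).mono_set
        Ioc_subset_Icc_self
    refine Integrable.mul_bdd (c := 1) h1.ofReal (by fun_prop) ?_
    filter_upwards [ae_restrict_mem measurableSet_Ioc] with t ht
    rw [norm_exp_neg_mul_ofReal, Real.exp_le_one_iff]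
    nlinarith [ht.1]
  · have h1 : IntegrableOn (fun t : ℝ => Complex.exp (-p * t)) (Ioi 1) :=
      (integrableOn_exp_neg_mul hp).mono_set (Ioi_subset_Ioi zero_le_one)
    refine Integrable.bdd_mul (c := G 1) h1 ?_ ?_
    · refine (Complex.continuous_ofReal.comp_continuousOn
        (hcont.mono (Ioi_subset_Ioi zero_le_one))).aestronglyMeasurable measurableSet_Ioi
    · filter_upwards [ae_restrict_mem measurableSet_Ioi] with t ht
      have ht1 : (1 : ℝ) < t := ht
      have ht0 : 0 < t := one_pos.trans ht1
      rw [Complex.norm_real, Real.norm_of_nonneg (hG.1.nonneg ht0)]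
      exact hG.1.antitoneOn (mem_Ioi.2 one_pos) ht0 ht1.le

theorem modulusQ_const_add_expSum {n : ℕ} (c : ℝ) (a : Fin n → ℝ) {r : Fin n → ℝ}
    (hr : ∀ i, 0 ≤ r i) {p : ℂ} (hp : 0 < p.re) :
    modulusQ (fun t => c + expSum a r t) p = finiteBernstein c a r p := by
  have hpr : ∀ i, 0 < (p + (r i : ℂ)).re := fun i => by
    simpa using add_pos_of_pos_of_nonneg hp (hr i)
  have e : ∀ t : ℝ, ((c + expSum a r t : ℝ) : ℂ) * Complex.exp (-p * t) =
      c * Complex.exp (-p * t) + ∑ i, (a i : ℂ) * Complex.exp (-(p + r i) * t) := by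
    intro t
    rw [expSum]
    push_cast
    rw [add_mul, Finset.sum_mul]
    congr 1
    refine Finset.sum_congr rfl fun i _ => ?_
    rw [mul_assoc, ← Complex.exp_add]
    congr 2
    ring
  have hp0 : p ≠ 0 := by rintro rfl; simp at hp
  rw [modulusQ, finiteBernstein]
  simp_rw [e]
  rw [integral_add ((integrableOn_exp_neg_mul hp).const_mul _)
    (integrable_finsetSum _ fun i _ => (integrableOn_exp_neg_mul (hpr i)).const_mul _),
    integral_finsetSum _ fun i _ => (integrableOn_exp_neg_mul (hpr i)).const_mul _,
    integral_const_mul, integral_exp_neg_mul hp, mul_add, mul_left_comm, mul_inv_cancel₀ hp0,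
    mul_one, Finset.mul_sum]
  congr 1
  refine Finset.sum_congr rfl fun i _ => ?_
  rw [integral_const_mul, integral_exp_neg_mul (hpr i)]
  ring

/-- The modulus `Q` of a completely monotone `G` is a pointwise limit of finite complete
Bernstein functions. -/
theorem IsLICM.exists_finiteBernstein_tendsto {G : ℝ → ℝ} (hG : IsLICM G) {c : ℝ}
    (hc : Tendsto G atTop (𝓝 c)) :
    ∃ (n : ℕ → ℕ) (a r : ∀ N, Fin (n N) → ℝ), (∀ N i, 0 ≤ a N i) ∧ (∀ N i, 0 ≤ r N i) ∧
      ∀ p : ℂ, 0 < p.re →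
        Tendsto (fun N => finiteBernstein c (a N) (r N) p) atTop (𝓝 (modulusQ G p)) := by
  obtain ⟨n, a, r, ha, hr, hb, hl⟩ := (hG.1.sub_const hc).exists_expSum_tendsto
  refine ⟨n, a, r, ha, hr, fun p hp => ?_⟩
  simp_rw [← modulusQ_const_add_expSum c (a _) (hr _) hp]
  refine Tendsto.const_mul _ ?_
  -- The majorant comes from `|c + expSum| ≤ |c| + (G t - c) + (G 1 - c) + 1`.
  have hi := (hG.integrableOn_mul_exp hp).norm.add
    ((integrableOn_exp_neg_mul hp).norm.const_mul (|c| + (|c| + |G 1 - c| + 1)))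
  refine tendsto_integral_of_dominated_convergence _ (fun N => ?_) hi (fun N => ?_) ?_
  · refine Continuous.aestronglyMeasurable ?_
    unfold expSum
    fun_prop
  · filter_upwards [ae_restrict_mem measurableSet_Ioi] with t ht
    have h1 := hb N t ht
    have h2 := expSum_nonneg (ha N) (r N) t
    rw [norm_mul, Pi.add_apply, norm_mul, ← add_mul]
    refine mul_le_mul_of_nonneg_right ?_ (norm_nonneg _)
    rw [Complex.norm_real, Complex.norm_real, Real.norm_eq_abs, Real.norm_eq_abs]
    have h3 := abs_add_le c (expSum (a N) (r N) t)
    rw [abs_of_nonneg h2] at h3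
    linarith [le_abs_self (G t), neg_le_abs c, le_abs_self (G 1 - c)]
  · filter_upwards [ae_restrict_mem measurableSet_Ioi] with t ht
    refine Tendsto.mul_const _ ((Complex.continuous_ofReal.tendsto _).comp ?_)
    simpa using (hl t ht).const_add c

theorem IsLICM.le_re_modulusQ {G : ℝ → ℝ} (hG : IsLICM G) {c : ℝ} (hc : Tendsto G atTop (𝓝 c))
    {p : ℂ} (hp : 0 < p.re) : c ≤ (modulusQ G p).re := by
  obtain ⟨n, a, r, ha, hr, h⟩ := hG.exists_finiteBernstein_tendsto hc
  exact ge_of_tendsto' ((Complex.continuous_re.tendsto _).comp (h p hp))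
    fun N => le_re_finiteBernstein (ha N) (hr N) hp

/-- For `s, c ≥ 0` not both zero, `1 / (s + c Q)` is a Stieltjes function. -/
theorem IsLICM.isStieltjes_inv_add_mul_modulusQ {G : ℝ → ℝ} (hG : IsLICM G) {c : ℝ}
    (hc : Tendsto G atTop (𝓝 c)) (hc0 : 0 < c) {s k : ℝ} (hs : 0 ≤ s) (hk : 0 ≤ k)
    (hsk : 0 < s + k) : IsStieltjes fun p => ((s : ℂ) + k * modulusQ G p)⁻¹ := by
  obtain ⟨n, a, r, ha, hr, h⟩ := hG.exists_finiteBernstein_tendsto hc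
  -- The constant term of the approximants must be positive; this is where `c > 0` covers the case
  -- `s = 0`.
  have hpos : 0 < s + k * c := by
    rcases hs.eq_or_lt with rfl | hs'
    · have : 0 < k := by linarith
      positivity
    · positivity
  refine IsStieltjes.of_tendsto (fun N => isStieltjes_finiteBernstein_inv hpos
    (a := fun i => k * a N i) (fun i => mul_nonneg hk (ha N i)) (hr N)) fun p hp => ?_
  have e : ∀ N, finiteBernstein (s + k * c) (fun i => k * a N i) (r N) p =
      s + k * finiteBernstein c (a N) (r N) p := by
    intro N
    simp only [finiteBernstein, mul_add, Finset.mul_sum]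
    push_cast
    simp only [mul_assoc, add_assoc]
  simp_rw [e]
  refine Tendsto.inv₀ (((h p hp).const_mul _).const_add _) fun h0 => ?_
  have h1 := hG.le_re_modulusQ hc hp
  have h2 := congrArg Complex.re h0
  simp at h2
  nlinarith

/-! ### The inverse square root as a limit of averages -/

theorem sq_add_sq_mul_sq_ne_zero {z : ℂ} (hz : 0 < z.re) {x y : ℝ} (hxy : x ≠ 0 ∨ y ≠ 0) :
    (x : ℂ) ^ 2 + (y : ℂ) ^ 2 * z ^ 2 ≠ 0 := by
  intro h
  have h1 : ((x : ℂ) + Complex.I * z * y) * (x - Complex.I * z * y) = 0 := by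
    rw [← h]
    ring_nf
    rw [Complex.I_sq]
    ring
  have hy : y = 0 := by
    rcases mul_eq_zero.1 h1 with h2 | h2
    · have := congrArg Complex.im h2
      simp at this
      exact this.resolve_left hz.ne'
    · have := congrArg Complex.im h2
      simp at this
      exact this.resolve_left hz.ne'
  have hx : x = 0 := by
    rw [hy] at h
    simpa using h
  exact hxy.elim (fun h => h hx) (fun h => h hy)

/-- Averages of the functions `z ↦ 1 / (sin² + z² cos²)` over `2 ^ n` equally spaced angles. -/
noncomputable def sqrtApprox : ℕ → ℝ → ℂ → ℂ
  | 0, θ, z => ((Real.sin θ : ℂ) ^ 2 + (Real.cos θ : ℂ) ^ 2 * z ^ 2)⁻¹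
  | n + 1, θ, z => (sqrtApprox n (θ / 2) z + sqrtApprox n (θ / 2 + Real.pi / 2) z) / 2

theorem one_add_sq_ne_zero {z : ℂ} (hz : 0 < z.re) : 1 + z ^ 2 ≠ 0 := by
  simpa using sq_add_sq_mul_sq_ne_zero hz (x := 1) (y := 1) (Or.inl one_ne_zero)

theorem one_add_ne_zero {z : ℂ} (hz : 0 < z.re) : 1 + z ≠ 0 := by
  intro h
  have := congrArg Complex.re h
  simp at this
  linarith

theorem re_two_mul_div_one_add_sq_pos {z : ℂ} (hz : 0 < z.re) :
    0 < (2 * z / (1 + z ^ 2)).re := by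
  have h := one_add_sq_ne_zero hz
  have h0 : 0 < Complex.normSq (1 + z ^ 2) := Complex.normSq_pos.2 h
  rw [Complex.div_re, ← add_div]
  refine div_pos ?_ h0
  simp [pow_two]
  nlinarith [mul_pos hz hz, mul_pos hz (mul_pos hz hz), mul_nonneg hz.le (mul_self_nonneg z.im)]

/-- By the double-angle formulas, averaging over `θ / 2` and `θ / 2 + π / 2` amounts to replacing
`z` by `2 z / (1 + z²)` at angle `θ`, up to a factor. -/
theorem sqrtApprox_succ (n : ℕ) (θ : ℝ) {z : ℂ} (hz : 0 < z.re) :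
    sqrtApprox (n + 1) θ z =
      2 / (1 + z ^ 2) * sqrtApprox n θ (2 * z / (1 + z ^ 2)) := by
  induction n generalizing θ with
  | zero =>
    have h1 := one_add_sq_ne_zero hz
    set φ := θ / 2 with hφ
    have hθ : θ = 2 * φ := by rw [hφ]; ring
    have hc : (Real.sin φ : ℂ) ^ 2 + (Real.cos φ : ℂ) ^ 2 = 1 := by
      exact_mod_cast Real.sin_sq_add_cos_sq φ
    have hsc : Real.sin φ ≠ 0 ∨ Real.cos φ ≠ 0 := by
      by_contra! h
      have := Real.sin_sq_add_cos_sq φ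
      rw [h.1, h.2] at this
      norm_num at this
    simp only [sqrtApprox, ← hφ, Real.sin_add_pi_div_two, Real.cos_add_pi_div_two]
    rw [hθ, Real.sin_two_mul, Real.cos_two_mul']
    have hA := sq_add_sq_mul_sq_ne_zero hz hsc
    have hB := sq_add_sq_mul_sq_ne_zero hz hsc.symm
    push_cast at hc hA hB ⊢
    set s := Complex.sin φ
    set c := Complex.cos φ
    have hden : (2 * s * c) ^ 2 + (c ^ 2 - s ^ 2) ^ 2 * (2 * z / (1 + z ^ 2)) ^ 2 =
        4 * ((s ^ 2 + c ^ 2 * z ^ 2) * (c ^ 2 + s ^ 2 * z ^ 2)) / (1 + z ^ 2) ^ 2 := by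
      have hs : s ^ 2 = 1 - c ^ 2 := by rw [← hc]; ring
      rw [div_pow, eq_div_iff (pow_ne_zero 2 h1), add_mul, mul_assoc ((c ^ 2 - s ^ 2) ^ 2),
        div_mul_cancel₀ _ (pow_ne_zero 2 h1), mul_pow, mul_pow, hs]
      ring
    rw [hden, neg_sq]
    have hsum : s ^ 2 + c ^ 2 * z ^ 2 + (c ^ 2 + s ^ 2 * z ^ 2) = 1 + z ^ 2 := by
      linear_combination (1 + z ^ 2) * hc
    rw [inv_add_inv hA hB, hsum]
    field_simp
    ring
  | succ n ih =>
    rw [sqrtApprox, ih, ih, sqrtApprox]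
    ring

theorem norm_one_sub_div_one_add_lt_one {z : ℂ} (hz : 0 < z.re) : ‖(1 - z) / (1 + z)‖ < 1 := by
  rw [norm_div, div_lt_one (norm_pos_iff.2 (one_add_ne_zero hz)), ← sq_lt_sq₀ (norm_nonneg _)
    (norm_nonneg _), ← Complex.normSq_eq_norm_sq, ← Complex.normSq_eq_norm_sq,
    Complex.normSq_apply, Complex.normSq_apply]
  simp
  nlinarith

/-- The map `z ↦ 2 z / (1 + z²)` squares the Cayley transform `(1 - z) / (1 + z)`, so `n` halvings
raise it to the power `2 ^ n`. It has modulus below `1` on the right half-plane, whence very fast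
convergence. -/
theorem mul_sqrtApprox_zero (n : ℕ) {z : ℂ} (hz : 0 < z.re) :
    z * sqrtApprox n 0 z =
      (1 + ((1 - z) / (1 + z)) ^ 2 ^ n) / (1 - ((1 - z) / (1 + z)) ^ 2 ^ n) := by
  induction n generalizing z with
  | zero =>
    have h1 := one_add_ne_zero hz
    have h0 : z ≠ 0 := by rintro rfl; simp at hz
    have e1 : 1 + (1 - z) / (1 + z) = 2 / (1 + z) := by field_simp; ring
    have e2 : 1 - (1 - z) / (1 + z) = 2 * z / (1 + z) := by field_simp; ring
    simp only [sqrtApprox, pow_zero, pow_one, e1, e2, Real.sin_zero, Real.cos_zero]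
    push_cast
    field_simp
    ring
  | succ n ih =>
    have h1 := one_add_ne_zero hz
    have h2 := one_add_sq_ne_zero hz
    have hw : (1 - 2 * z / (1 + z ^ 2)) / (1 + 2 * z / (1 + z ^ 2)) =
        ((1 - z) / (1 + z)) ^ 2 := by
      have e1 : 1 - 2 * z / (1 + z ^ 2) = (1 - z) ^ 2 / (1 + z ^ 2) := by field_simp; ring
      have e2 : 1 + 2 * z / (1 + z ^ 2) = (1 + z) ^ 2 / (1 + z ^ 2) := by field_simp; ring
      rw [e1, e2, div_div_div_cancel_right₀ h2, div_pow]
    have h := ih (re_two_mul_div_one_add_sq_pos hz)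
    rw [hw, ← pow_mul, ← pow_succ'] at h
    rw [sqrtApprox_succ n 0 hz, ← h]
    ring

theorem tendsto_sqrtApprox {z : ℂ} (hz : 0 < z.re) :
    Tendsto (fun n => sqrtApprox n 0 z) atTop (𝓝 z⁻¹) := by
  have h0 : z ≠ 0 := by rintro rfl; simp at hz
  have hw : Tendsto (fun n : ℕ => ((1 - z) / (1 + z)) ^ 2 ^ n) atTop (𝓝 0) :=
    (tendsto_pow_atTop_nhds_zero_of_norm_lt_one (norm_one_sub_div_one_add_lt_one hz)).comp
      (tendsto_pow_atTop_atTop_of_one_lt one_lt_two)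
  have h1 := (hw.const_add 1).div (hw.const_sub 1) (by simp)
  simp only [add_zero, sub_zero, div_one] at h1
  have h2 := h1.const_mul z⁻¹
  rw [mul_one] at h2
  refine h2.congr fun n => ?_
  rw [Pi.div_apply, ← mul_sqrtApprox_zero n hz, inv_mul_cancel_left₀ h0]

theorem cpow_half_sq (q : ℂ) : (q ^ (1 / 2 : ℂ)) ^ 2 = q := by
  have := Complex.cpow_nat_inv_pow q two_ne_zero
  rwa [Nat.cast_ofNat, ← one_div] at this

theorem re_cpow_half_pos {q : ℂ} (hq : 0 < q.re) : 0 < (q ^ (1 / 2 : ℂ)).re := by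
  have h0 : q ≠ 0 := by rintro rfl; simp at hq
  have h2 : (1 / 2 : ℂ) = ((1 / 2 : ℝ) : ℂ) := by push_cast; rfl
  rw [Complex.cpow_def_of_ne_zero h0, Complex.exp_re, h2, Complex.im_mul_ofReal, Complex.log_im]
  refine mul_pos (Real.exp_pos _) (Real.cos_pos_of_mem_Ioo ?_)
  have h1 := abs_lt.1 (Complex.abs_arg_lt_pi_div_two_iff.2 (Or.inl hq))
  constructor <;> linarith [Real.pi_pos]

theorem IsLICM.isStieltjes_sqrtApprox {G : ℝ → ℝ} (hG : IsLICM G) {c : ℝ}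
    (hc : Tendsto G atTop (𝓝 c)) (hc0 : 0 < c) (n : ℕ) (θ : ℝ) :
    IsStieltjes fun p => sqrtApprox n θ (modulusQ G p ^ (1 / 2 : ℂ)) := by
  induction n generalizing θ with
  | zero =>
    refine (hG.isStieltjes_inv_add_mul_modulusQ hc hc0 (sq_nonneg (Real.sin θ))
      (sq_nonneg (Real.cos θ)) (by rw [Real.sin_sq_add_cos_sq]; exact one_pos)).congr
      fun p hp => ?_
    rw [sqrtApprox, cpow_half_sq]
    push_cast
    rfl
  | succ n ih =>
    refine (((ih (θ / 2)).add (ih (θ / 2 + Real.pi / 2))).const_mul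
      (by norm_num : (0 : ℝ) ≤ 1 / 2)).congr fun p hp => ?_
    rw [sqrtApprox]
    push_cast
    ring

/-- `Q ^ (-1/2)` is a Stieltjes function. -/
theorem IsLICM.isStieltjes_inv_sqrt_modulusQ {G : ℝ → ℝ} (hG : IsLICM G) {c : ℝ}
    (hc : Tendsto G atTop (𝓝 c)) (hc0 : 0 < c) :
    IsStieltjes fun p => (modulusQ G p ^ (1 / 2 : ℂ))⁻¹ :=
  IsStieltjes.of_tendsto (fun n => hG.isStieltjes_sqrtApprox hc hc0 n 0) fun _ hp =>
    tendsto_sqrtApprox (re_cpow_half_pos (hc0.trans_le (hG.le_re_modulusQ hc hp)))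

/-! ### From mixing measures to measures on the half-line -/

/-- The interior of the compactified half-line. -/
def unitInterval.interior : Set unitInterval := {u | 0 < (u : ℝ) ∧ (u : ℝ) < 1}

theorem unitInterval.measurableSet_interior : MeasurableSet unitInterval.interior :=
  (measurableSet_lt measurable_const measurable_subtype_coe).inter
    (measurableSet_lt measurable_subtype_coe measurable_const)

/-- The measure on `]0,∞[` that corresponds to a mixing measure on the compactified half-line. -/
noncomputable def halfLineMeasure (σ : Measure unitInterval) : Measure ℝ :=
  ((σ.restrict unitInterval.interior).withDensity fun u => ENNReal.ofReal (u : ℝ)⁻¹).map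
    fun u : unitInterval => (1 - (u : ℝ)) / u

theorem measurable_one_sub_div : Measurable fun u : unitInterval => (1 - (u : ℝ)) / u := by
  fun_prop

theorem measurable_ofReal_coe_inv :
    Measurable fun u : unitInterval => ENNReal.ofReal (u : ℝ)⁻¹ := by
  fun_prop

theorem lintegral_halfLineMeasure (σ : Measure unitInterval) {g : ℝ → ℝ≥0∞} (hg : Measurable g) :
    ∫⁻ r, g r ∂(halfLineMeasure σ) =
      ∫⁻ u in unitInterval.interior, ENNReal.ofReal (u : ℝ)⁻¹ * g ((1 - (u : ℝ)) / u) ∂σ := by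
  rw [halfLineMeasure, lintegral_map hg measurable_one_sub_div]
  exact lintegral_withDensity_eq_lintegral_mul _ measurable_ofReal_coe_inv
    (hg.comp measurable_one_sub_div)

theorem halfLineMeasure_apply (σ : Measure unitInterval) {s : Set ℝ} (hs : MeasurableSet s) :
    halfLineMeasure σ s = ∫⁻ u in unitInterval.interior,
      ENNReal.ofReal (u : ℝ)⁻¹ * s.indicator 1 ((1 - (u : ℝ)) / u) ∂σ := by
  rw [← lintegral_halfLineMeasure σ (measurable_one.indicator hs), lintegral_indicator_one hs]

theorem halfLineMeasure_Iic_zero (σ : Measure unitInterval) : halfLineMeasure σ (Iic 0) = 0 := by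
  rw [halfLineMeasure_apply σ measurableSet_Iic, setLIntegral_congr_fun
    unitInterval.measurableSet_interior (g := fun _ => 0), lintegral_zero]
  intro u hu
  have : 0 < (1 - (u : ℝ)) / u := div_pos (sub_pos.2 hu.2) hu.1
  simp [this]

theorem halfLineMeasure_Iic_lt_top (σ : Measure unitInterval) [IsFiniteMeasure σ] (R : ℝ) :
    halfLineMeasure σ (Iic R) < ∞ := by
  rw [halfLineMeasure_apply σ measurableSet_Iic]
  refine (setLIntegral_mono (g := fun _ => ENNReal.ofReal (1 + R)) measurable_const
    fun u hu => ?_).trans_lt ?_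
  · by_cases h : (1 - (u : ℝ)) / u ≤ R
    · rw [indicator_of_mem (mem_Iic.2 h), Pi.one_apply, mul_one]
      refine ENNReal.ofReal_le_ofReal ?_
      rw [sub_div, div_self hu.1.ne', one_div] at h
      linarith
    · rw [indicator_of_notMem (by simpa using h)]
      simp
  · rw [lintegral_const]
    exact ENNReal.mul_lt_top ENNReal.ofReal_lt_top (measure_lt_top _ _)

theorem isSpectralMeasure_halfLineMeasure (σ : Measure unitInterval) [IsFiniteMeasure σ] :
    IsSpectralMeasure (halfLineMeasure σ) where
  locallyFinite := ⟨fun x => ⟨Iic (x + 1), Iic_mem_nhds (by linarith),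
    halfLineMeasure_Iic_lt_top σ _⟩⟩
  measure_neg := measure_mono_null Iio_subset_Iic_self (halfLineMeasure_Iic_zero σ)
  lintegral_lt_top := by
    refine (setLIntegral_le_lintegral _ _).trans_lt ?_
    rw [lintegral_halfLineMeasure σ (by fun_prop)]
    refine (setLIntegral_mono (g := fun _ => 1) measurable_const fun u hu => ?_).trans_lt ?_
    -- With `r = (1 - u) / u`, the weight `1 / (1 + r) = u` cancels the density `1 / u`, leaving at
    -- most the mass of `σ`.
    · have h : 1 + (1 - (u : ℝ)) / u = (u : ℝ)⁻¹ := by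
        have := hu.1.ne'
        field_simp
        ring
      rw [h]
      exact ENNReal.mul_inv_le_one _
    · simp

theorem integral_halfLineMeasure (σ : Measure unitInterval) (p : ℂ) :
    ∫ r in Ioi (0 : ℝ), (p + (r : ℂ))⁻¹ ∂(halfLineMeasure σ) =
      ∫ u in unitInterval.interior, stieltjesKernel p u ∂σ := by
  have hae : ∀ᵐ r ∂(halfLineMeasure σ), r ∈ Ioi (0 : ℝ) := by
    rw [ae_iff]
    convert halfLineMeasure_Iic_zero σ using 2
    ext r
    simp
  rw [Measure.restrict_eq_self_of_ae_mem hae, halfLineMeasure,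
    integral_map measurable_one_sub_div.aemeasurable
      (Measurable.aestronglyMeasurable (by fun_prop)),
    integral_withDensity_eq_integral_toReal_smul measurable_ofReal_coe_inv
      (Eventually.of_forall fun _ => ENNReal.ofReal_lt_top)]
  refine setIntegral_congr_fun unitInterval.measurableSet_interior fun u hu => ?_
  have h0 : (u : ℂ) ≠ 0 := by exact_mod_cast hu.1.ne'
  simp only [stieltjesKernel]
  rw [ENNReal.toReal_ofReal (inv_nonneg.2 hu.1.le), Complex.real_smul]
  push_cast
  rw [← mul_inv]
  congr 1
  field_simp
  ring

theorem unitInterval.compl_interior : (unitInterval.interior)ᶜ = {0} ∪ {1} := by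
  ext u
  simp only [unitInterval.interior, mem_compl_iff, mem_ofPred_eq, not_and, not_lt, mem_union,
    mem_singleton_iff, Subtype.ext_iff, Icc.coe_zero, Icc.coe_one]
  have h0 := u.2.1
  have h1 := u.2.2
  constructor
  · intro h
    rcases h0.eq_or_lt with h' | h'
    · exact Or.inl h'.symm
    · exact Or.inr (le_antisymm h1 (h h'))
  · rintro (h | h) h' <;> linarith

/-- A Stieltjes function that is bounded on the positive half-axis has the representation
`B + ∫ ν(dr) / (p + r)` over `]0,∞[`. -/
theorem IsStieltjes.exists_rep {f : ℂ → ℂ} (hf : IsStieltjes f) {M : ℝ}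
    (hM : ∀ x : ℝ, 0 < x → ‖f x‖ ≤ M) :
    ∃ (B : ℝ) (ν : Measure ℝ), 0 ≤ B ∧ IsSpectralMeasure ν ∧ ν {0} = 0 ∧
      ∀ p : ℂ, 0 < p.re → f p = B + ∫ r in Ioi (0 : ℝ), (p + (r : ℂ))⁻¹ ∂ν := by
  obtain ⟨σ, hσ⟩ := hf
  -- The point `u = 1` is `r = 0`. An atom there contributes `σ {1} / x` to `f x`, so boundedness
  -- forces `σ {1} ≤ x M` for all `x > 0`.
  have h1 : (σ : Measure unitInterval).real {1} = 0 := by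
    refine le_antisymm ?_ measureReal_nonneg
    have hle : ∀ x : ℝ, 0 < x → (σ : Measure unitInterval).real {1} ≤ x * M := by
      intro x hx
      have hxc : 0 < (x : ℂ).re := by simpa
      set k : unitInterval → ℝ := fun u => (1 - (u : ℝ) + x * u)⁻¹ with hk
      have hkc : ∀ u, stieltjesKernel x u = (k u : ℂ) := fun u => by
        simp [stieltjesKernel, hk]
      have hknn : ∀ u, 0 ≤ k u := fun u => by
        have := re_stieltjesKernel_denom_pos hxc u
        simp at this
        exact inv_nonneg.2 this.le
      have hint : Integrable k (σ : Measure unitInterval) := by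
        have := (integrable_stieltjesKernel hxc σ).re
        refine this.congr (Eventually.of_forall fun u => ?_)
        simp [hkc]
      have h2 : ∫ u in {1}, k u ∂(σ : Measure unitInterval) ≤ ∫ u, k u ∂σ :=
        setIntegral_le_integral hint (Eventually.of_forall hknn)
      have h3 : ∫ u, k u ∂(σ : Measure unitInterval) ≤ M := by
        refine (le_abs_self _).trans ((le_of_eq ?_).trans (hM x hx))
        rw [hσ x hxc]
        simp_rw [hkc]
        rw [integral_complex_ofReal, Complex.norm_real, Real.norm_eq_abs]
      rw [integral_singleton] at h2
      have h4 : k 1 = x⁻¹ := by simp [hk]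
      rw [h4, smul_eq_mul, ← div_eq_mul_inv] at h2
      rw [mul_comm, ← div_le_iff₀ hx]
      exact h2.trans h3
    have hlim : Tendsto (fun x : ℝ => x * M) (𝓝[>] 0) (𝓝 0) := by
      have : Tendsto (fun x : ℝ => x * M) (𝓝 0) (𝓝 (0 * M)) := tendsto_id.mul_const M
      rw [zero_mul] at this
      exact this.mono_left nhdsWithin_le_nhds
    exact ge_of_tendsto hlim (eventually_nhdsWithin_of_forall hle)
  -- The kernel is constantly `1` at `u = 0`, so the mass at `r = ∞` is the constant `B`.
  refine ⟨(σ : Measure unitInterval).real {0}, halfLineMeasure σ, measureReal_nonneg,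
    isSpectralMeasure_halfLineMeasure _,
    measure_mono_null (by simp) (halfLineMeasure_Iic_zero (σ : Measure unitInterval)),
    fun p hp => ?_⟩
  have hint := integrable_stieltjesKernel hp σ
  rw [integral_halfLineMeasure, hσ p hp,
    ← integral_add_compl unitInterval.measurableSet_interior hint, unitInterval.compl_interior,
    setIntegral_union (by simp) (measurableSet_singleton _) hint.integrableOn hint.integrableOn,
    integral_singleton, integral_singleton, h1, zero_smul, add_zero, add_comm]
  simp [stieltjesKernel]

theorem norm_cpow_half_ge {q : ℂ} {c : ℝ} (hq : c ≤ q.re) :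
    √c ≤ ‖q ^ (1 / 2 : ℂ)‖ := by
  refine Real.sqrt_le_iff.2 ⟨norm_nonneg _, ?_⟩
  rw [← norm_pow, cpow_half_sq]
  exact hq.trans (Complex.re_le_norm q)

theorem IsLICM.exists_isWaveNumberRep {G : ℝ → ℝ} (hG : IsLICM G) {c : ℝ}
    (hc : Tendsto G atTop (𝓝 c)) (hc0 : 0 < c) (ρ : ℝ) :
    ∃ (B : ℝ) (ν : Measure ℝ), IsWaveNumberRep G ρ B ν := by
  have hf := (hG.isStieltjes_inv_sqrt_modulusQ hc hc0).const_mul (Real.sqrt_nonneg ρ)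
  obtain ⟨B, ν, hB, hν, hν0, h⟩ := hf.exists_rep (M := √ρ * (√c)⁻¹) fun x hx => by
    have hx' : 0 < (x : ℂ).re := by simpa
    rw [norm_mul, norm_inv, Complex.norm_real, Real.norm_of_nonneg (Real.sqrt_nonneg ρ)]
    refine mul_le_mul_of_nonneg_left ?_ (Real.sqrt_nonneg ρ)
    exact inv_anti₀ (Real.sqrt_pos.2 hc0) (norm_cpow_half_ge (hG.le_re_modulusQ hc hx'))
  refine ⟨B, ν, hB, hν, hν0, fun p hp => ?_⟩
  have := h p hp
  rw [waveNumber, waveNumberExt, dispAtten, mul_comm (B : ℂ), ← mul_add, ← this]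
  ring

/-! ### Low-frequency limits -/

/-- Abelian theorem: `Q(x) → G(∞)` as `x ↓ 0`. -/
theorem IsLICM.tendsto_modulusQ {G : ℝ → ℝ} (hG : IsLICM G) {c : ℝ}
    (hc : Tendsto G atTop (𝓝 c)) :
    Tendsto (fun x : ℝ => modulusQ G x) (𝓝[>] 0) (𝓝 (c : ℂ)) := by
  have e : ∀ x : ℝ, 0 < x → modulusQ G x =
      ∫ s in Ioi (0 : ℝ), (G (x⁻¹ * s) : ℂ) * Complex.exp (-1 * s) := by
    intro x hx
    have h := integral_comp_mul_left_Ioi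
      (fun t : ℝ => (G t : ℂ) * Complex.exp (-(x : ℂ) * t)) 0 (inv_pos.2 hx)
    rw [mul_zero, inv_inv, Complex.real_smul] at h
    rw [modulusQ, ← h]
    refine integral_congr_ae (Eventually.of_forall fun s => ?_)
    have hx0 : (x : ℂ) ≠ 0 := by exact_mod_cast hx.ne'
    push_cast
    congr 2
    field_simp
  have hlim : Tendsto (fun x : ℝ => ∫ s in Ioi (0 : ℝ),
      (G (x⁻¹ * s) : ℂ) * Complex.exp (-1 * s)) (𝓝[>] 0)
      (𝓝 (∫ s in Ioi (0 : ℝ), (c : ℂ) * Complex.exp (-1 * s))) := by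
    refine tendsto_integral_filter_of_dominated_convergence
      (fun s => ‖(G s : ℂ) * Complex.exp (-1 * s)‖) ?_ ?_
      (hG.integrableOn_mul_exp (p := 1) (by simp)).norm ?_
    · filter_upwards [self_mem_nhdsWithin] with x hx
      refine ContinuousOn.aestronglyMeasurable ?_ measurableSet_Ioi
      refine ContinuousOn.mul ?_ (by fun_prop)
      exact Complex.continuous_ofReal.comp_continuousOn
        (hG.1.1.continuousOn.comp (by fun_prop) fun s hs =>
          mem_Ioi.2 (mul_pos (inv_pos.2 (mem_Ioi.1 hx)) (mem_Ioi.1 hs)))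
    · filter_upwards [Ioc_mem_nhdsGT one_pos] with x hx
      filter_upwards [ae_restrict_mem measurableSet_Ioi] with s hs
      have hs' : 0 < s := hs
      -- After the substitution `t = s / x`, monotonicity gives `G (s / x) ≤ G s` for `x ≤ 1`, so
      -- the integrand at `x = 1` dominates.
      have h1 : s ≤ x⁻¹ * s := le_mul_of_one_le_left hs'.le ((one_le_inv₀ hx.1).2 hx.2)
      have h2 : 0 < x⁻¹ * s := hs'.trans_le h1
      rw [norm_mul, norm_mul]
      refine mul_le_mul_of_nonneg_right ?_ (norm_nonneg _)
      rw [Complex.norm_real, Complex.norm_real, Real.norm_of_nonneg (hG.1.nonneg hs'),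
        Real.norm_of_nonneg (hG.1.nonneg h2)]
      exact hG.1.antitoneOn hs h2 h1
    · filter_upwards [ae_restrict_mem measurableSet_Ioi] with s hs
      refine Tendsto.mul_const _ ((Complex.continuous_ofReal.tendsto _).comp (hc.comp ?_))
      exact tendsto_inv_nhdsGT_zero.atTop_mul_const hs
  rw [integral_const_mul, integral_exp_neg_mul (p := 1) (by simp), inv_one, mul_one] at hlim
  refine hlim.congr' ?_
  filter_upwards [self_mem_nhdsWithin] with x hx
  exact (e x hx).symm

theorem IsLICM.tendsto_waveNumber_div {G : ℝ → ℝ} (hG : IsLICM G) {c : ℝ}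
    (hc : Tendsto G atTop (𝓝 c)) (hc0 : 0 < c) (ρ : ℝ) :
    Tendsto (fun x : ℝ => waveNumber G ρ x / x) (𝓝[>] 0)
      (𝓝 ((1 / lowFreqSpeed c ρ : ℝ) : ℂ)) := by
  have h1 : Tendsto (fun x : ℝ => (√ρ : ℂ) / modulusQ G x ^ (1 / 2 : ℂ)) (𝓝[>] 0)
      (𝓝 ((√ρ : ℂ) / (c : ℂ) ^ (1 / 2 : ℂ))) := by
    refine Tendsto.div tendsto_const_nhds ((hG.tendsto_modulusQ hc).cpow tendsto_const_nhds
      (Or.inl (by simpa using hc0))) ?_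
    intro h
    have := re_cpow_half_pos (q := (c : ℂ)) (by simpa using hc0)
    rw [h] at this
    simp at this
  have h2 : ((1 / lowFreqSpeed c ρ : ℝ) : ℂ) = (√ρ : ℂ) / (c : ℂ) ^ (1 / 2 : ℂ) := by
    have : (1 / 2 : ℂ) = ((1 / 2 : ℝ) : ℂ) := by push_cast; rfl
    rw [lowFreqSpeed, Real.sqrt_div hc0.le, one_div_div, this, ← Complex.ofReal_cpow hc0.le,
      ← Real.sqrt_eq_rpow]
    push_cast
    rfl
  rw [h2]
  refine h1.congr' ?_
  filter_upwards [self_mem_nhdsWithin] with x hx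
  have hx0 : (x : ℂ) ≠ 0 := by exact_mod_cast (mem_Ioi.1 hx).ne'
  rw [waveNumber]
  field_simp

theorem IsSpectralMeasure.integrableOn_inv_add {ν : Measure ℝ} (hν : IsSpectralMeasure ν) {x : ℝ}
    (hx : 0 < x) : IntegrableOn (fun r : ℝ => (x + r)⁻¹) (Ioi 0) ν := by
  have h1 : IntegrableOn (fun r : ℝ => (1 + r)⁻¹) (Ioi 0) ν := by
    refine ⟨Measurable.aestronglyMeasurable (by fun_prop), ?_⟩
    refine lt_of_eq_of_lt (setLIntegral_congr_fun measurableSet_Ioi fun r hr => ?_)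
      hν.lintegral_lt_top
    have : 0 < 1 + r := add_pos one_pos hr
    rw [Real.enorm_of_nonneg (inv_nonneg.2 this.le), ENNReal.ofReal_inv_of_pos this]
  refine (h1.const_mul (1 + x⁻¹)).mono' (Measurable.aestronglyMeasurable (by fun_prop)) ?_
  filter_upwards [ae_restrict_mem measurableSet_Ioi] with r hr
  have hr' : 0 < r := hr
  rw [Real.norm_of_nonneg (by positivity), ← div_eq_mul_inv, inv_eq_one_div,
    div_le_div_iff₀ (by positivity) (by positivity)]
  have : (1 + x⁻¹) * (x + r) = x + r + 1 + x⁻¹ * r := by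
    field_simp
    ring
  rw [this]
  have : 0 < x⁻¹ * r := by positivity
  linarith

theorem integral_inv_add_ofReal (ν : Measure ℝ) (x : ℝ) :
    ∫ r in Ioi (0 : ℝ), ((x : ℂ) + (r : ℂ))⁻¹ ∂ν =
      ((∫ r in Ioi (0 : ℝ), (x + r)⁻¹ ∂ν : ℝ) : ℂ) := by
  rw [← integral_complex_ofReal]
  push_cast
  rfl

/-- If `∫ ν(dr) / (x + r)` has a finite limit at `0`, then this limit is `∫ ν(dr) / r`. -/
theorem IsSpectralMeasure.lintegral_inv_eq {ν : Measure ℝ} (hν : IsSpectralMeasure ν) {D : ℝ}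
    (hD : Tendsto (fun x : ℝ => ∫ r in Ioi (0 : ℝ), (x + r)⁻¹ ∂ν) (𝓝[>] 0) (𝓝 D)) :
    ∫⁻ r in Ioi (0 : ℝ), (ENNReal.ofReal r)⁻¹ ∂ν = ENNReal.ofReal D := by
  set x : ℕ → ℝ := fun n => 1 / ((n : ℝ) + 1) with hx
  have hpos : ∀ n, 0 < x n := fun n => by positivity
  have hanti : Antitone x := fun m n h => Nat.one_div_le_one_div h
  have hx0 : Tendsto x atTop (𝓝 0) := tendsto_one_div_add_atTop_nhds_zero_nat
  have hx1 : Tendsto x atTop (𝓝[>] 0) :=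
    tendsto_nhdsWithin_iff.2 ⟨hx0, Eventually.of_forall hpos⟩
  have h1 := (ENNReal.continuous_ofReal.tendsto D).comp (hD.comp hx1)
  have e : ∀ n, ENNReal.ofReal (∫ r in Ioi (0 : ℝ), (x n + r)⁻¹ ∂ν) =
      ∫⁻ r in Ioi (0 : ℝ), (ENNReal.ofReal (x n + r))⁻¹ ∂ν := by
    intro n
    rw [ofReal_integral_eq_lintegral_ofReal (hν.integrableOn_inv_add (hpos n))]
    · refine setLIntegral_congr_fun measurableSet_Ioi fun r hr => ?_
      exact ENNReal.ofReal_inv_of_pos (add_pos (hpos n) hr)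
    · filter_upwards [ae_restrict_mem measurableSet_Ioi] with r hr
      exact inv_nonneg.2 (add_pos (hpos n) hr).le
  have h2 : Tendsto (fun n => ∫⁻ r in Ioi (0 : ℝ), (ENNReal.ofReal (x n + r))⁻¹ ∂ν) atTop
      (𝓝 (∫⁻ r in Ioi (0 : ℝ), (ENNReal.ofReal r)⁻¹ ∂ν)) := by
    refine lintegral_tendsto_of_tendsto_of_monotone (fun n => by fun_prop)
      (Eventually.of_forall fun r m n h => ?_) (Eventually.of_forall fun r => ?_)
    · exact ENNReal.inv_le_inv.2 (ENNReal.ofReal_le_ofReal (by linarith [hanti h]))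
    · refine Tendsto.inv ((ENNReal.continuous_ofReal.tendsto _).comp ?_)
      simpa using hx0.add_const r
  exact tendsto_nhds_unique h2 (h1.congr e)

theorem norm_inv_add_ofReal_le {p : ℂ} (hp : 0 ≤ p.re) {r : ℝ} (hr : 0 < r) :
    ‖(p + (r : ℂ))⁻¹‖ ≤ r⁻¹ := by
  rw [norm_inv]
  refine inv_anti₀ hr ?_
  have := Complex.re_le_norm (p + r)
  simp at this
  linarith

/-- Finiteness of `∫ ν(dr) / r`, obtained from real `x` alone, upgrades the limit: `|p + r| ≥ r` for
`Re p ≥ 0`, so dominated convergence applies up to the imaginary axis. -/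
theorem tendsto_integral_inv_add {ν : Measure ℝ} {D : ℝ} (hD0 : 0 ≤ D)
    (hD : ∫⁻ r in Ioi (0 : ℝ), (ENNReal.ofReal r)⁻¹ ∂ν = ENNReal.ofReal D) :
    Tendsto (fun p : ℂ => ∫ r in Ioi (0 : ℝ), (p + (r : ℂ))⁻¹ ∂ν)
      (𝓝[{p : ℂ | 0 ≤ p.re ∧ p ≠ 0}] 0) (𝓝 (D : ℂ)) := by
  have e : ∫⁻ r in Ioi (0 : ℝ), ENNReal.ofReal r⁻¹ ∂ν = ENNReal.ofReal D := by
    rw [← hD]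
    exact setLIntegral_congr_fun measurableSet_Ioi fun r hr => ENNReal.ofReal_inv_of_pos hr
  have hnn : 0 ≤ᵐ[ν.restrict (Ioi 0)] fun r : ℝ => r⁻¹ := by
    filter_upwards [ae_restrict_mem measurableSet_Ioi] with r hr
    exact inv_nonneg.2 (le_of_lt hr)
  have hm : AEStronglyMeasurable (fun r : ℝ => r⁻¹) (ν.restrict (Ioi 0)) :=
    Measurable.aestronglyMeasurable (by fun_prop)
  have hint : IntegrableOn (fun r : ℝ => r⁻¹) (Ioi 0) ν := by
    refine ⟨hm, ?_⟩
    rw [hasFiniteIntegral_iff_ofReal hnn, e]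
    exact ENNReal.ofReal_lt_top
  have hval : ∫ r in Ioi (0 : ℝ), ((r : ℂ))⁻¹ ∂ν = (D : ℂ) := by
    have h1 : ∫ r in Ioi (0 : ℝ), r⁻¹ ∂ν = D := by
      rw [integral_eq_lintegral_of_nonneg_ae hnn hm, e, ENNReal.toReal_ofReal hD0]
    rw [← h1, ← integral_complex_ofReal]
    push_cast
    rfl
  rw [← hval]
  refine tendsto_integral_filter_of_dominated_convergence (fun r : ℝ => r⁻¹)
    (Eventually.of_forall fun p => Measurable.aestronglyMeasurable (by fun_prop)) ?_ hint ?_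
  · filter_upwards [self_mem_nhdsWithin] with p hp
    filter_upwards [ae_restrict_mem measurableSet_Ioi] with r hr
    exact norm_inv_add_ofReal_le hp.1 hr
  · filter_upwards [ae_restrict_mem measurableSet_Ioi] with r hr
    have hr0 : (0 : ℂ) + (r : ℂ) ≠ 0 := by
      rw [zero_add]
      exact_mod_cast (mem_Ioi.1 hr).ne'
    have h : Tendsto (fun p : ℂ => (p + (r : ℂ))⁻¹) (𝓝 0) (𝓝 ((0 + (r : ℂ))⁻¹)) :=
      (tendsto_id.add_const _).inv₀ hr0
    rw [zero_add] at h
    exact h.mono_left nhdsWithin_le_nhds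

theorem tendsto_neg_I_mul :
    Tendsto (fun ω : ℝ => -(Complex.I * (ω : ℂ))) (𝓝[≠] 0)
      (𝓝[{p : ℂ | 0 ≤ p.re ∧ p ≠ 0}] 0) := by
  refine tendsto_nhdsWithin_iff.2 ⟨?_, ?_⟩
  · have : Continuous fun ω : ℝ => -(Complex.I * (ω : ℂ)) := by fun_prop
    have h := this.tendsto 0
    simp only [Complex.ofReal_zero, mul_zero, neg_zero] at h
    exact h.mono_left nhdsWithin_le_nhds
  · filter_upwards [self_mem_nhdsWithin] with ω hω
    have : ω ≠ 0 := hω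
    simp [this]

theorem mainTheorem6 (G : ℝ → ℝ) (hG : IsLICM G) (Ginf ρ : ℝ)
    (hlim : Tendsto G atTop (𝓝 Ginf)) (hGinf : 0 < Ginf) (hρ : 0 < ρ) :
    (∃ (B : ℝ) (ν : Measure ℝ), IsWaveNumberRep G ρ B ν) ∧
    ∀ (B : ℝ) (ν : Measure ℝ), IsWaveNumberRep G ρ B ν →
      Tendsto (fun p : ℂ => waveNumberExt B ν p / p) (𝓝[{p : ℂ | 0 ≤ p.re ∧ p ≠ 0}] 0)
        (𝓝 ((1 / lowFreqSpeed Ginf ρ : ℝ) : ℂ)) ∧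
      Tendsto (fun ω : ℝ => attenuation ν ω / ω) (𝓝[≠] 0) (𝓝 0) ∧
      ∃ D : ℝ,
        Tendsto (fun ω : ℝ => dispersion ν ω / ω) (𝓝[≠] 0) (𝓝 D) ∧
        Tendsto (fun ω : ℝ => 1 / phaseSpeed B ν ω) (𝓝[≠] 0) (𝓝 (1 / lowFreqSpeed Ginf ρ)) ∧
        1 / lowFreqSpeed Ginf ρ = ((wavefrontSpeed B)⁻¹).toReal + D ∧
        0 ≤ D ∧
        ∫⁻ r in Ici (0 : ℝ), (ENNReal.ofReal r)⁻¹ ∂ν = ENNReal.ofReal D ∧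
        ∫⁻ r in Ici (0 : ℝ), (ENNReal.ofReal r)⁻¹ ∂ν < ∞ := by
  refine ⟨hG.exists_isWaveNumberRep hlim hGinf ρ, fun B ν hrep => ?_⟩
  set L := 1 / lowFreqSpeed Ginf ρ with hL
  set F : ℂ → ℂ := fun p => ∫ r in Ioi (0 : ℝ), (p + (r : ℂ))⁻¹ ∂ν with hF
  have hdisp : ∀ p, dispAtten ν p = p * F p := fun _ => rfl
  have hext : ∀ p, waveNumberExt B ν p = p * (B + F p) := fun p => by
    rw [waveNumberExt, hdisp]
    ring
  have hreal : Tendsto (fun x : ℝ => ∫ r in Ioi (0 : ℝ), (x + r)⁻¹ ∂ν) (𝓝[>] 0)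
      (𝓝 (L - B)) := by
    have h1 := (Complex.continuous_re.tendsto _).comp
      (hG.tendsto_waveNumber_div hlim hGinf ρ)
    rw [Complex.ofReal_re] at h1
    refine (h1.sub_const B).congr' ?_
    filter_upwards [self_mem_nhdsWithin] with x hx
    have hx' : 0 < x := hx
    have hx0 : (x : ℂ) ≠ 0 := by exact_mod_cast hx'.ne'
    have h2 : F x = ((∫ r in Ioi (0 : ℝ), (x + r)⁻¹ ∂ν : ℝ) : ℂ) := integral_inv_add_ofReal ν x
    rw [Function.comp_apply, hrep.rep x (by simpa using hx'), hext, mul_div_cancel_left₀ _ hx0, h2]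
    simp
  set D := L - B with hD
  have hD0 : 0 ≤ D := by
    refine ge_of_tendsto hreal ?_
    filter_upwards [self_mem_nhdsWithin] with x hx
    exact setIntegral_nonneg measurableSet_Ioi fun r hr => inv_nonneg.2 (add_pos hx hr).le
  have hlint := hrep.spectral.lintegral_inv_eq hreal
  have hFlim : Tendsto F (𝓝[{p : ℂ | 0 ≤ p.re ∧ p ≠ 0}] 0) (𝓝 (D : ℂ)) :=
    tendsto_integral_inv_add hD0 hlint
  have hFω := hFlim.comp tendsto_neg_I_mul
  -- The integrand is `∞` at `r = 0`, which is harmless only because `ν {0} = 0`.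
  have hIci : ∫⁻ r in Ici (0 : ℝ), (ENNReal.ofReal r)⁻¹ ∂ν = ENNReal.ofReal D := by
    rw [← hlint]
    refine setLIntegral_congr ?_
    rw [← Ioi_union_left]
    exact union_ae_eq_left_of_ae_eq_empty (ae_eq_empty.2 hrep.measure_zero)
  refine ⟨?_, ?_, D, ?_, ?_, ?_, hD0, hIci, hIci ▸ ENNReal.ofReal_lt_top⟩
  · have h1 := hFlim.const_add (B : ℂ)
    have h2 : (B : ℂ) + (D : ℂ) = (L : ℂ) := by rw [hD]; push_cast; ring
    rw [h2] at h1
    refine h1.congr' ?_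
    filter_upwards [self_mem_nhdsWithin] with p hp
    rw [hext, mul_div_cancel_left₀ _ hp.2]
  -- Since `β(-iω) = -iω F(-iω)`, one has `A(ω) / ω = Im F(-iω)` and `D(ω) / ω = Re F(-iω)`, and the
  -- limit of `F` is real.
  · have h1 := (Complex.continuous_im.tendsto _).comp hFω
    rw [Complex.ofReal_im] at h1
    refine h1.congr' ?_
    filter_upwards [self_mem_nhdsWithin] with ω hω
    have hω0 : ω ≠ 0 := hω
    rw [attenuation, hdisp, Function.comp_apply, Function.comp_apply, eq_div_iff hω0]
    simp [mul_comm]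
  · have h1 := (Complex.continuous_re.tendsto _).comp hFω
    rw [Complex.ofReal_re] at h1
    refine h1.congr' ?_
    filter_upwards [self_mem_nhdsWithin] with ω hω
    have hω0 : ω ≠ 0 := hω
    rw [dispersion, hdisp, Function.comp_apply, Function.comp_apply, eq_div_iff hω0]
    simp [mul_comm]
  · have h1 := ((Complex.continuous_re.tendsto _).comp hFω).const_add B
    rw [Complex.ofReal_re, hD, add_sub_cancel] at h1
    refine h1.congr' ?_
    filter_upwards [self_mem_nhdsWithin] with ω hω
    have hω0 : ω ≠ 0 := hω
    rw [phaseSpeed, hext, Function.comp_apply, Function.comp_apply, one_div_div,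
      eq_div_iff (neg_ne_zero.2 hω0)]
    simp [mul_comm]
  · rw [wavefrontSpeed, inv_inv, ENNReal.toReal_ofReal hrep.nonneg, hD]
    ring
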